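/- Let $L_1,L_2>0$ and $\Omega=(0,L_1)\times(0,L_2)$. Let $\lambda$ be a real function on $\Omega$ satisfying the positive $0$-condition: there are positive constants $c_0,c_1$ with $c_0\le\lambda\le c_1$ a.e. in $\Omega$, and the weak gradient satisfies $\nabla\lambda\in L^\infty(\Omega)$. For $\theta\in L^2(\Omega)$ put $T\theta=\lambda\theta_x+\theta_y$ in the sense of distributions, where $\lambda\theta_x:=(\lambda\theta)_x-\lambda_x\theta$, and let $$\mathcal X_1^0(\Omega)=\{\theta\in L^2(\Omega):T\theta\in L^2(\Omega)\},\qquad \|\theta\|_{\mathcal X_1^0}=\bigl(\|\theta\|_{L^2(\Omega)}^2+\|T\theta\|_{L^2(\Omega)}^2\bigr)^{1/2}.$$ Let $H^{-1}(0,L)$ be the dual of $H^1_0(0,L)$, with $L^2(0,L)\subset H^{-1}(0,L)$ through $f\mapsto\bigl(u\mapsto\int_0^L fu\bigr)$. Then every $\theta\in\mathcal X_1^0(\Omega)$ has a well-defined trace on each of the four sides of $\Omega$. Precisely, $x\mapsto\theta(x,\cdot)$ agrees for a.e. $x\in(0,L_1)$ with an element of $C([0,L_1];H^{-1}(0,L_2))$,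 whose values at $x=0$ and $x=L_1$ are uniquely determined by $\theta$ and are by definition the traces $\theta|_{x=0},\theta|_{x=L_1}\in H^{-1}(0,L_2)$; and $y\mapsto\theta(\cdot,y)$ agrees for a.e. $y\in(0,L_2)$ with an element of $C([0,L_2];H^{-1}(0,L_1))$, whose values at $y=0$ and $y=L_2$ are uniquely determined by $\theta$ and are by definition the traces $\theta|_{y=0},\theta|_{y=L_2}\in H^{-1}(0,L_1)$. The four trace operators $$\theta\mapsto\theta|_{x=0},\ \theta|_{x=L_1}\ \text{ from }\mathcal X_1^0(\Omega)\text{ into }H^{-1}(0,L_2),\qquad \theta\mapsto\theta|_{y=0},\ \theta|_{y=L_2}\ \text{ from }\mathcal X_1^0(\Omega)\text{ into }H^{-1}(0,L_1)$$ are linear and continuous. If $\theta\in\mathcal X_1^0(\Omega)$ is continuous on $\overline\Omega$, its traces are its restrictions to the sides. -/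

import Mathlib

open MeasureTheory Set TopologicalSpace
open scoped ENNReal Distributions

noncomputable section

/-- The open interval `(0, L)`. -/
def openInterval (L : ℝ) : Opens ℝ := ⟨Ioo 0 L, isOpen_Ioo⟩

/-- The open rectangle `Ω = (0, L₁) × (0, L₂)`. -/
def openRect (L₁ L₂ : ℝ) : Opens (ℝ × ℝ) :=
  ⟨Ioo 0 L₁ ×ˢ Ioo 0 L₂, isOpen_Ioo.prod isOpen_Ioo⟩

/-- Lebesgue measure on `(0, L)`. -/
abbrev intervalMeasure (L : ℝ) : Measure ℝ := volume.restrict (openInterval L)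

/-- Lebesgue measure on `Ω = (0, L₁) × (0, L₂)`. -/
abbrev rectMeasure (L₁ L₂ : ℝ) : Measure (ℝ × ℝ) := volume.restrict (openRect L₁ L₂)

/-! ### The spaces `H¹₀(0, L)` and `H⁻¹(0, L)` -/

/-- The pairs `(φ, φ')` in `L²(0, L) × L²(0, L)`, where `φ` is a smooth function with compact
support in `(0, L)`. -/
def testJets (L : ℝ) :
    Submodule ℝ (WithLp 2 (Lp ℝ 2 (intervalMeasure L) × Lp ℝ 2 (intervalMeasure L))) where
  carrier := {u | ∃ φ : 𝓓(openInterval L, ℝ),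
    u.fst =ᵐ[intervalMeasure L] φ ∧ u.snd =ᵐ[intervalMeasure L] deriv φ}
  zero_mem' := by
    refine ⟨0, ?_, ?_⟩
    · filter_upwards [Lp.coeFn_zero ℝ 2 (intervalMeasure L)] with x hx
      simpa using hx
    · filter_upwards [Lp.coeFn_zero ℝ 2 (intervalMeasure L)] with x hx
      have : ((0 : 𝓓(openInterval L, ℝ)) : ℝ → ℝ) = fun _ => 0 := by ext; simp
      rw [this]
      simpa using hx
  add_mem' := by
    rintro u v ⟨φ, h1, h2⟩ ⟨ψ, h3, h4⟩
    refine ⟨φ + ψ, ?_, ?_⟩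
    · filter_upwards [h1, h3, Lp.coeFn_add u.fst v.fst] with x a b c
      rw [WithLp.add_fst, c, Pi.add_apply, a, b]
      simp
    · filter_upwards [h2, h4, Lp.coeFn_add u.snd v.snd] with x a b c
      have hφ : DifferentiableAt ℝ φ x := (φ.contDiff.differentiable (by simp)) x
      have hψ : DifferentiableAt ℝ ψ x := (ψ.contDiff.differentiable (by simp)) x
      have : ((φ + ψ : 𝓓(openInterval L, ℝ)) : ℝ → ℝ) = fun y => φ y + ψ y := by ext; simp
      rw [this, deriv_fun_add hφ hψ, WithLp.add_snd, c, Pi.add_apply, a, b]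
  smul_mem' := by
    rintro k u ⟨φ, h1, h2⟩
    refine ⟨k • φ, ?_, ?_⟩
    · filter_upwards [h1, Lp.coeFn_smul k u.fst] with x a c
      simp [c, a]
    · filter_upwards [h2, Lp.coeFn_smul k u.snd] with x a c
      have hφ : DifferentiableAt ℝ φ x := (φ.contDiff.differentiable (by simp)) x
      have : ((k • φ : 𝓓(openInterval L, ℝ)) : ℝ → ℝ) = fun y => k * φ y := by ext; simp
      rw [this, deriv_const_mul k hφ]
      simp [c, a]

/-- `H¹₀(0, L)`: the closure of the smooth functions with compact support in `(0, L)` for the norm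
`(‖u‖² + ‖u'‖²)^{1/2}`. An element `u` is stored as the pair `(u, u')`, so that the norm inherited
from the Hilbert product `L² × L²` is the `H¹` norm. -/
abbrev H10 (L : ℝ) :
    Submodule ℝ (WithLp 2 (Lp ℝ 2 (intervalMeasure L) × Lp ℝ 2 (intervalMeasure L))) :=
  (testJets L).topologicalClosure

/-- `H⁻¹(0, L)`: the dual of `H¹₀(0, L)`, with the dual norm. -/
abbrev HMinusOne (L : ℝ) : Type := StrongDual ℝ (H10 L)

/-- `F ∈ H⁻¹(0, L)` is (the image in `H⁻¹(0, L)` of) the function `f ∈ L²(0, L)`. -/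
def IsRepresentedBy {L : ℝ} (F : HMinusOne L) (f : ℝ → ℝ) : Prop :=
  MemLp f 2 (intervalMeasure L) ∧
    ∀ u : H10 L, F u = ∫ t, f t * u.1.fst t ∂(intervalMeasure L)

/-! ### The coefficient `λ` and the space `X₁⁰(Ω)` -/

/-- `g` is the weak partial derivative of `f` in the direction `v` on the open set `U`. -/
def IsWeakPartial (U : Opens (ℝ × ℝ)) (v : ℝ × ℝ) (f g : ℝ × ℝ → ℝ) : Prop :=
  LocallyIntegrableOn f U ∧ LocallyIntegrableOn g U ∧
    ∀ φ : 𝓓(U, ℝ), ∫ p in U, f p * fderiv ℝ φ p v = -∫ p in U, g p * φ p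

/-- The positive `0`-condition on `Ω`: `c₀ ≤ λ ≤ c₁` with positive constants `c₀, c₁`, and the weak
gradient of `λ` is in `L^∞(Ω)`. -/
structure PositiveZeroCondition (L₁ L₂ : ℝ) (lam : ℝ × ℝ → ℝ) : Prop where
  bounds : ∃ c₀ c₁ : ℝ, 0 < c₀ ∧ 0 < c₁ ∧
    ∀ᵐ p ∂(rectMeasure L₁ L₂), c₀ ≤ lam p ∧ lam p ≤ c₁
  grad_x : ∃ lx : ℝ × ℝ → ℝ, MemLp lx ∞ (rectMeasure L₁ L₂) ∧
    IsWeakPartial (openRect L₁ L₂) (1, 0) lam lx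
  grad_y : ∃ ly : ℝ × ℝ → ℝ, MemLp ly ∞ (rectMeasure L₁ L₂) ∧
    IsWeakPartial (openRect L₁ L₂) (0, 1) lam ly

/-- `Tθ = λ θ_x + θ_y = g` on `Ω` in the sense of distributions, where the product `λ θ_x` is the
distribution `(λ θ)_x - λ_x θ`, that is `⟨λ θ_x, φ⟩ = -∫ θ (λ φ)_x`. -/
def IsTransport (L₁ L₂ : ℝ) (lam θ g : ℝ × ℝ → ℝ) : Prop :=
  ∃ lx : ℝ × ℝ → ℝ, IsWeakPartial (openRect L₁ L₂) (1, 0) lam lx ∧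
    ∀ φ : 𝓓(openRect L₁ L₂, ℝ),
      ∫ p in openRect L₁ L₂, g p * φ p =
        -∫ p in openRect L₁ L₂,
          θ p * (lam p * fderiv ℝ φ p (1, 0) + lx p * φ p + fderiv ℝ φ p (0, 1))

theorem ae_eq_of_forall_test {U : Opens (ℝ × ℝ)} {f g : ℝ × ℝ → ℝ}
    (hf : LocallyIntegrableOn f U) (hg : LocallyIntegrableOn g U)
    (h : ∀ φ : 𝓓(U, ℝ), ∫ p in U, f p * φ p = ∫ p in U, g p * φ p) :
    f =ᵐ[volume.restrict U] g := by
  have key : ∀ᵐ p, p ∈ (U : Set (ℝ × ℝ)) → (f - g) p = 0 := by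
    refine U.isOpen.ae_eq_zero_of_integral_contDiff_smul_eq_zero (hf.sub hg) ?_
    intro φ hφ hc hs
    let ψ : 𝓓(U, ℝ) := ⟨φ, by exact_mod_cast hφ, hc, hs⟩
    have e : ∀ p, φ p • (f - g) p = f p * ψ p - g p * ψ p := by
      intro p
      change φ p * (f p - g p) = f p * φ p - g p * φ p
      ring
    have i1 : Integrable (fun p => f p * ψ p) := by
      simpa [mul_comm] using ψ.integrable_bilin (ContinuousLinearMap.mul ℝ ℝ) hf
    have i2 : Integrable (fun p => g p * ψ p) := by
      simpa [mul_comm] using ψ.integrable_bilin (ContinuousLinearMap.mul ℝ ℝ) hg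
    have z : ∀ p, p ∉ (U : Set (ℝ × ℝ)) → ψ p = 0 := fun p hp =>
      image_eq_zero_of_notMem_tsupport fun hp' => hp (hs hp')
    simp_rw [e]
    rw [integral_sub i1 i2, ← setIntegral_eq_integral_of_forall_compl_eq_zero (s := U),
      ← setIntegral_eq_integral_of_forall_compl_eq_zero (s := U) (f := fun p => g p * ψ p),
      h ψ, sub_self]
    · intro p hp; simp [z p hp]
    · intro p hp; simp [z p hp]
  rw [Filter.EventuallyEq, ae_restrict_iff' U.isOpen.measurableSet]
  filter_upwards [key] with p hp hU
  exact sub_eq_zero.mp (hp hU)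

/-- Weak partial derivatives are unique almost everywhere. -/
theorem IsWeakPartial.ae_eq {U : Opens (ℝ × ℝ)} {v : ℝ × ℝ} {f g g' : ℝ × ℝ → ℝ}
    (h : IsWeakPartial U v f g) (h' : IsWeakPartial U v f g') : g =ᵐ[volume.restrict U] g' :=
  ae_eq_of_forall_test h.2.1 h'.2.1 fun φ => neg_injective ((h.2.2 φ).symm.trans (h'.2.2 φ))

theorem memLp_two_test {L₁ L₂ : ℝ} {φ : ℝ × ℝ → ℝ} (hc : Continuous φ)
    (hs : HasCompactSupport φ) : MemLp φ 2 (rectMeasure L₁ L₂) :=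
  hc.memLp_of_hasCompactSupport hs

theorem continuous_fderiv_test {U : Opens (ℝ × ℝ)} (φ : 𝓓(U, ℝ)) (v : ℝ × ℝ) :
    Continuous (fun p => fderiv ℝ φ p v) :=
  (φ.contDiff.continuous_fderiv (by simp)).clm_apply continuous_const

theorem hasCompactSupport_fderiv_test {U : Opens (ℝ × ℝ)} (φ : 𝓓(U, ℝ)) (v : ℝ × ℝ) :
    HasCompactSupport (fun p => fderiv ℝ φ p v) :=
  φ.hasCompactSupport.fderiv_apply ℝ v

/-- The transposed operator applied to a test function is in `L²(Ω)`. -/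
theorem PositiveZeroCondition.memLp_adjoint {L₁ L₂ : ℝ} {lam lx : ℝ × ℝ → ℝ}
    (h : PositiveZeroCondition L₁ L₂ lam) (hlx : IsWeakPartial (openRect L₁ L₂) (1, 0) lam lx)
    (φ : 𝓓(openRect L₁ L₂, ℝ)) :
    MemLp (fun p => lam p * fderiv ℝ φ p (1, 0) + lx p * φ p + fderiv ℝ φ p (0, 1)) 2
      (rectMeasure L₁ L₂) := by
  have hlam : MemLp lam ∞ (rectMeasure L₁ L₂) := by
    obtain ⟨c₀, c₁, h0, h1, hb⟩ := h.bounds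
    refine memLp_top_of_bound hlx.1.aestronglyMeasurable c₁ ?_
    filter_upwards [hb] with p hp
    rw [Real.norm_eq_abs, abs_of_nonneg (h0.le.trans hp.1)]
    exact hp.2
  have hlx' : MemLp lx ∞ (rectMeasure L₁ L₂) := by
    obtain ⟨l, hl, hw⟩ := h.grad_x
    exact (memLp_congr_ae (hw.ae_eq hlx)).mp hl
  have m1 := memLp_two_test (L₁ := L₁) (L₂ := L₂) (continuous_fderiv_test φ (1, 0))
    (hasCompactSupport_fderiv_test φ (1, 0))
  have m2 := memLp_two_test (L₁ := L₁) (L₂ := L₂) φ.continuous φ.hasCompactSupport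
  have m3 := memLp_two_test (L₁ := L₁) (L₂ := L₂) (continuous_fderiv_test φ (0, 1))
    (hasCompactSupport_fderiv_test φ (0, 1))
  exact ((m1.mul' hlam).add (m2.mul' hlx')).add m3

/-- The space `X₁⁰(Ω) = {θ ∈ L²(Ω) : Tθ ∈ L²(Ω)}` of real-valued functions, with the graph norm
`(‖θ‖² + ‖Tθ‖²)^{1/2}`. An element `θ` is stored as the pair `(θ, Tθ)` in the Hilbert product
`L²(Ω) × L²(Ω)`; the second component is determined by the first one. -/
def X10 {L₁ L₂ : ℝ} {lam : ℝ × ℝ → ℝ} (h : PositiveZeroCondition L₁ L₂ lam) :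
    Submodule ℝ (WithLp 2 (Lp ℝ 2 (rectMeasure L₁ L₂) × Lp ℝ 2 (rectMeasure L₁ L₂))) where
  carrier := {w | IsTransport L₁ L₂ lam w.fst w.snd}
  zero_mem' := by
    obtain ⟨lx, -, hlx⟩ := h.grad_x
    refine ⟨lx, hlx, fun φ => ?_⟩
    have e := Lp.coeFn_zero ℝ 2 (rectMeasure L₁ L₂)
    rw [integral_eq_zero_of_ae, integral_eq_zero_of_ae, neg_zero]
    · filter_upwards [e] with p hp
      simp only [WithLp.zero_fst, hp, Pi.zero_apply, zero_mul]
    · filter_upwards [e] with p hp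
      simp only [WithLp.zero_snd, hp, Pi.zero_apply, zero_mul]
  add_mem' := by
    rintro w w' ⟨lx, hlx, hw⟩ ⟨lx', hlx', hw'⟩
    refine ⟨lx, hlx, fun φ => ?_⟩
    have m := h.memLp_adjoint hlx φ
    have mφ := memLp_two_test (L₁ := L₁) (L₂ := L₂) φ.continuous φ.hasCompactSupport
    have hw'' : ∫ p in openRect L₁ L₂, w'.snd p * φ p = -∫ p in openRect L₁ L₂,
        w'.fst p * (lam p * fderiv ℝ φ p (1, 0) + lx p * φ p + fderiv ℝ φ p (0, 1)) := by
      rw [hw' φ]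
      congr 1
      refine integral_congr_ae ?_
      filter_upwards [hlx.ae_eq hlx'] with p hp
      rw [hp]
    have e1 : ∫ p in openRect L₁ L₂, (w + w').snd p * φ p =
        ∫ p in openRect L₁ L₂, (w.snd p * φ p + w'.snd p * φ p) := by
      refine integral_congr_ae ?_
      filter_upwards [Lp.coeFn_add w.snd w'.snd] with p hp
      simp only [WithLp.add_snd, hp, Pi.add_apply, add_mul]
    have e2 : ∫ p in openRect L₁ L₂, (w + w').fst p *
          (lam p * fderiv ℝ φ p (1, 0) + lx p * φ p + fderiv ℝ φ p (0, 1)) =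
        ∫ p in openRect L₁ L₂,
          (w.fst p * (lam p * fderiv ℝ φ p (1, 0) + lx p * φ p + fderiv ℝ φ p (0, 1)) +
          w'.fst p * (lam p * fderiv ℝ φ p (1, 0) + lx p * φ p + fderiv ℝ φ p (0, 1))) := by
      refine integral_congr_ae ?_
      filter_upwards [Lp.coeFn_add w.fst w'.fst] with p hp
      simp only [WithLp.add_fst, hp, Pi.add_apply, add_mul]
    have i1 := integral_add ((Lp.memLp w.snd).integrable_mul mφ)
      ((Lp.memLp w'.snd).integrable_mul mφ)
    have i2 := integral_add ((Lp.memLp w.fst).integrable_mul m)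
      ((Lp.memLp w'.fst).integrable_mul m)
    simp only [Pi.mul_apply] at i1 i2
    rw [e1, e2, i1, i2, hw φ, hw'', neg_add]
  smul_mem' := by
    rintro k w ⟨lx, hlx, hw⟩
    refine ⟨lx, hlx, fun φ => ?_⟩
    have e1 : ∫ p in openRect L₁ L₂, (k • w).snd p * φ p =
        ∫ p in openRect L₁ L₂, k * (w.snd p * φ p) := by
      refine integral_congr_ae ?_
      filter_upwards [Lp.coeFn_smul k w.snd] with p hp
      simp [hp, mul_assoc]
    have e2 : ∫ p in openRect L₁ L₂, (k • w).fst p *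
          (lam p * fderiv ℝ φ p (1, 0) + lx p * φ p + fderiv ℝ φ p (0, 1)) =
        ∫ p in openRect L₁ L₂, k *
          (w.fst p * (lam p * fderiv ℝ φ p (1, 0) + lx p * φ p + fderiv ℝ φ p (0, 1))) := by
      refine integral_congr_ae ?_
      filter_upwards [Lp.coeFn_smul k w.fst] with p hp
      simp only [WithLp.smul_fst, hp, Pi.smul_apply, smul_eq_mul, mul_assoc]
    rw [e1, e2, integral_const_mul, integral_const_mul, hw φ, mul_neg]

/-- An element `θ` of `X₁⁰(Ω)` as a function (class) on `Ω`. -/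
def X10fun {L₁ L₂ : ℝ} {lam : ℝ × ℝ → ℝ} {h : PositiveZeroCondition L₁ L₂ lam}
    (θ : X10 h) : ℝ × ℝ → ℝ :=
  θ.1.fst

/-- `X₁⁰(Ω)` is a space of functions: an element is determined by its function `θ`. -/
theorem X10fun_injective {L₁ L₂ : ℝ} {lam : ℝ × ℝ → ℝ} {h : PositiveZeroCondition L₁ L₂ lam}
    {θ θ' : X10 h} (e : X10fun θ =ᵐ[rectMeasure L₁ L₂] X10fun θ') : θ = θ' := by
  obtain ⟨w, lx, hlx, hw⟩ := θ
  obtain ⟨w', lx', hlx', hw'⟩ := θ'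
  have e' : w.fst =ᵐ[rectMeasure L₁ L₂] w'.fst := e
  have loc : ∀ f : Lp ℝ 2 (rectMeasure L₁ L₂), LocallyIntegrableOn f (openRect L₁ L₂) :=
    fun f => locallyIntegrableOn_of_locallyIntegrable_restrict
      ((Lp.memLp f).locallyIntegrable (by norm_num))
  have e2 : w.snd =ᵐ[rectMeasure L₁ L₂] w'.snd := by
    refine ae_eq_of_forall_test (loc _) (loc _) fun φ => ?_
    rw [hw φ, hw' φ]
    congr 1
    refine integral_congr_ae ?_
    filter_upwards [e', hlx.ae_eq hlx'] with p h1 h2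
    rw [h1, h2]
  refine Subtype.ext ?_
  apply (WithLp.equiv 2 _).injective
  exact Prod.ext (Lp.ext e') (Lp.ext e2)

/-! ### Traces -/

/-- Let `s : (0, ℓ) → L²(0, L)` be a family of functions. `F ∈ H⁻¹(0, L)` is the trace of `s` at
`a ∈ [0, ℓ]` if `s` agrees almost everywhere on `(0, ℓ)` with an element `S` of
`C([0, ℓ]; H⁻¹(0, L))` such that `S(a) = F`. -/
def IsTraceAt {L : ℝ} (l : ℝ) (s : ℝ → ℝ → ℝ) (a : ℝ) (F : HMinusOne L) : Prop :=
  ∃ S : ℝ → HMinusOne L, ContinuousOn S (Icc 0 l) ∧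
    (∀ᵐ t ∂(intervalMeasure l), IsRepresentedBy (S t) (s t)) ∧ S a = F

end

noncomputable section

/-! The equation `λ θ_x + θ_y = Tθ` can be solved for either derivative in divergence form: `θ_x =
(Tθ/λ - (λ_y/λ²) θ) - ∂_y(θ/λ)` and `θ_y = (Tθ + λ_x θ) - ∂_x(λ θ)`. As `λ`, `1/λ` and `∇λ` are
bounded, both have the shape `∂ₜθ = a - ∂ₓb` with `a`, `b` in `L²` depending linearly and
continuously on `θ` in the graph norm. So `θ` is `L²` in time with values in `L²`, `∂ₜθ` is `L²` in
time with values in `H⁻¹`, and `θ` has a representative continuous into `H⁻¹`.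

The representative is written down explicitly, without vector-valued integrals. Fix a test function
`ρ` on `(0, l)` with integral one and let `K_t(s) = ∫_{r ≤ s} ρ - 1_{s > t}`. For `t` in `(0, l)`
this kernel vanishes at both ends and `K_t' = ρ - δ_t`, so integration by parts gives `w(t) = ∫ w ρ
+ ∫ w' K_t` (`ae_eq_of_weak_deriv`). With `w(t) = ∫ θ(t,x) u(x) dx` this becomes `S(t)u = ∬ θ ρ u +
∬ K_t (a u + b u')`, which is `traceOp`: it makes sense for every `t`, is bounded in `θ`, and is
continuous in `t` because `t ↦ K_t` is continuous into `L²` (`continuous_meanKernelLp`).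

The equation for `θ_x` requires the test function `φ/λ`, which is not smooth;
`PositiveZeroCondition.integral_div` justifies it by mollifying `λ`. Uniqueness of the traces holds
because continuous families that agree a.e. on `[0, l]` agree at the endpoints. -/

instance isFiniteMeasure_intervalMeasure (L : ℝ) : IsFiniteMeasure (intervalMeasure L) :=
  inferInstanceAs (IsFiniteMeasure (volume.restrict (Ioo 0 L)))

/-! ### Test functions on an interval and their primitives -/

theorem continuous_integral_Iic {f : ℝ → ℝ} (hf : Integrable f) :
    Continuous fun s => ∫ x in Iic s, f x := by
  have : (fun s => ∫ x in Iic s, f x) = fun s => (∫ x in Iic 0, f x) + ∫ x in 0..s, f x := by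
    funext s
    rw [← intervalIntegral.integral_Iic_sub_Iic hf.integrableOn hf.integrableOn]
    ring
  rw [this]
  exact continuous_const.add
    (intervalIntegral.continuous_primitive (fun _ _ => hf.intervalIntegrable) _)

theorem integral_Iic_eq_intervalIntegral {f : ℝ → ℝ} (hf : Integrable f) {a : ℝ}
    (h : ∀ x ≤ a, f x = 0) (s : ℝ) : ∫ x in Iic s, f x = ∫ x in a..s, f x := by
  rw [← intervalIntegral.integral_Iic_sub_Iic hf.integrableOn hf.integrableOn,
    setIntegral_eq_zero_of_forall_eq_zero (t := Iic a) (fun x hx => h x hx), sub_zero]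

theorem TestFunction.eq_zero_of_notMem {E : Type*} [NormedAddCommGroup E] [NormedSpace ℝ E]
    {U : Opens E} (f : 𝓓(U, ℝ)) {x : E} (hx : x ∉ (U : Set E)) : f x = 0 :=
  image_eq_zero_of_notMem_tsupport fun h => hx (f.tsupport_subset h)

theorem TestFunction.integrable_volume {E : Type*} [NormedAddCommGroup E] [NormedSpace ℝ E]
    [MeasureSpace E] [OpensMeasurableSpace E] [IsFiniteMeasureOnCompacts (volume : Measure E)]
    {U : Opens E} (f : 𝓓(U, ℝ)) : Integrable f :=
  f.continuous.integrable_of_hasCompactSupport f.hasCompactSupport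

theorem TestFunction.setIntegral_mul {E : Type*} [NormedAddCommGroup E] [NormedSpace ℝ E]
    [MeasureSpace E] {U : Opens E} (f : 𝓓(U, ℝ)) (g : E → ℝ) :
    ∫ x in U, g x * f x = ∫ x, g x * f x :=
  setIntegral_eq_integral_of_forall_compl_eq_zero fun x hx => by
    rw [f.eq_zero_of_notMem hx, mul_zero]

/-- A test function on `(0, l)` vanishes outside a compact subinterval. -/
theorem TestFunction.exists_Icc {l : ℝ} (hl : 0 < l) (f : 𝓓(openInterval l, ℝ)) :
    ∃ a b, 0 < a ∧ b < l ∧ ∀ x, x ∉ Ioo a b → f x = 0 := by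
  rcases (tsupport f).eq_empty_or_nonempty with h | h
  · refine ⟨l / 2, l / 2, by linarith, by linarith, fun x _ => ?_⟩
    exact image_eq_zero_of_notMem_tsupport (by simp [h])
  · have hc : IsCompact (tsupport f) := f.hasCompactSupport
    have h1 := f.tsupport_subset (hc.sInf_mem h)
    have h2 := f.tsupport_subset (hc.sSup_mem h)
    change _ ∈ Ioo 0 l at h1 h2
    -- The endpoints are moved halfway from the hull of the support towards `0` and `l`, so that the
    -- support lies in the open interval between them.
    refine ⟨sInf (tsupport f) / 2, (sSup (tsupport f) + l) / 2, by linarith [h1.1],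
      by linarith [h2.2], fun x hx => image_eq_zero_of_notMem_tsupport fun hx' => hx ⟨?_, ?_⟩⟩
    · linarith [csInf_le hc.bddBelow hx', h1.1]
    · linarith [le_csSup hc.bddAbove hx', h2.2]

/-- A test function on `(0, l)` with vanishing integral is the derivative of a test function. -/
theorem TestFunction.exists_primitive {l : ℝ} (hl : 0 < l) (f : 𝓓(openInterval l, ℝ))
    (hf : ∫ x, f x = 0) :
    ∃ η : 𝓓(openInterval l, ℝ), (∀ s, η s = ∫ x in Iic s, f x) ∧ deriv η = f := by
  obtain ⟨a, b, ha, hb, hab⟩ := f.exists_Icc hl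
  have e : (fun s => ∫ x in Iic s, f x) = fun s => ∫ x in a..s, f x := by
    funext s
    exact integral_Iic_eq_intervalIntegral f.integrable_volume
      (fun x hx => hab x fun h => absurd h.1 (not_lt.2 hx)) s
  have hd : deriv (fun s => ∫ x in Iic s, f x) = f := by
    rw [e]
    funext s
    exact f.continuous.deriv_integral _ _ _
  have hdiff : Differentiable ℝ (fun s => ∫ x in Iic s, f x) := by
    rw [e]
    exact intervalIntegral.differentiable_integral_of_continuous f.continuous
  have hsupp : tsupport (fun s => ∫ x in Iic s, f x) ⊆ Icc a b := by
    refine closure_minimal (fun s hs => ?_) isClosed_Icc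
    by_contra hs'
    apply hs
    rw [mem_Icc, not_and_or, not_le, not_le] at hs'
    rcases hs' with h | h
    · exact setIntegral_eq_zero_of_forall_eq_zero fun x hx =>
        hab x fun h' => absurd h'.1 (not_lt.2 ((mem_Iic.1 hx).trans h.le))
    -- Here the vanishing integral enters: beyond `b` the primitive equals the total integral.
    · simp only
      rw [setIntegral_eq_integral_of_forall_compl_eq_zero, hf]
      exact fun x hx => hab x fun h' => hx (mem_Iic.2 (h'.2.le.trans h.le))
  refine ⟨⟨fun s => ∫ x in Iic s, f x, ?_, isCompact_Icc.of_isClosed_subset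
    (isClosed_tsupport _) hsupp, hsupp.trans fun x hx => ⟨ha.trans_le hx.1, hx.2.trans_lt hb⟩⟩,
    fun s => rfl, hd⟩
  have := contDiff_infty_iff_deriv.2 ⟨hdiff, hd.symm ▸ f.contDiff⟩
  exact_mod_cast this

theorem exists_test_integral_eq_one {l : ℝ} (hl : 0 < l) :
    ∃ ρ : 𝓓(openInterval l, ℝ), ∫ x, ρ x = 1 := by
  let φ : ContDiffBump (l / 2) := ⟨l / 8, l / 4, by linarith, by linarith⟩
  refine ⟨⟨φ.normed volume, φ.contDiff_normed, φ.hasCompactSupport_normed, ?_⟩,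
    φ.integral_normed⟩
  rw [φ.tsupport_normed_eq, Real.closedBall_eq_Icc]
  intro x hx
  change x ∈ Ioo 0 l
  have : φ.rOut = l / 4 := rfl
  rw [this] at hx
  exact ⟨by linarith [hx.1], by linarith [hx.2]⟩

/-! ### Reconstruction of a function from its mean and its weak derivative -/

/-- The kernel `K_t(s) = ∫_{r ≤ s} ρ(r) dr - 1_{s > t}`, which reconstructs a function from its
mean against `ρ` and its derivative. -/
def meanKernel (ρ : ℝ → ℝ) (t s : ℝ) : ℝ :=
  (∫ r in Iic s, ρ r) - (Ioi t).indicator 1 s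

theorem measurable_meanKernel {ρ : ℝ → ℝ} (hρ : Integrable ρ) :
    Measurable (fun p : ℝ × ℝ => meanKernel ρ p.1 p.2) := by
  have h1 : Measurable fun s => ∫ r in Iic s, ρ r :=
    (continuous_integral_Iic hρ).measurable
  have h2 : Measurable fun p : ℝ × ℝ => (Ioi p.1).indicator (1 : ℝ → ℝ) p.2 := by
    have : (fun p : ℝ × ℝ => (Ioi p.1).indicator (1 : ℝ → ℝ) p.2) =
        {p : ℝ × ℝ | p.1 < p.2}.indicator 1 := by
      funext p; simp [indicator_apply]
    rw [this]
    exact measurable_one.indicator (measurableSet_lt measurable_fst measurable_snd)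
  exact (h1.comp measurable_snd).sub h2

/-- Uniformity in `t` and `s` is what makes `G(s) K_t(s)` integrable on the product, so that Fubini
applies. -/
theorem abs_meanKernel_le {ρ : ℝ → ℝ} (hρ : Integrable ρ) (t s : ℝ) :
    |meanKernel ρ t s| ≤ (∫ r, |ρ r|) + 1 := by
  refine (abs_sub _ _).trans (add_le_add ?_ ?_)
  · exact (abs_integral_le_integral_abs).trans
      (setIntegral_le_integral hρ.abs (Filter.Eventually.of_forall fun _ => abs_nonneg _))
  · by_cases h : s ∈ Ioi t <;> simp [indicator_apply, mem_Ioi] <;> split_ifs <;> simp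

/-- A function with weak derivative `G` on `(0, l)` is a.e. equal to its mean against `ρ` plus the
integral of `G` against the kernel. -/
theorem ae_eq_of_weak_deriv {l : ℝ} (hl : 0 < l) (ρ : 𝓓(openInterval l, ℝ))
    (hρ : ∫ x, ρ x = 1) {w G : ℝ → ℝ} (hw : Integrable w (intervalMeasure l))
    (hG : Integrable G (intervalMeasure l))
    (h : ∀ η : 𝓓(openInterval l, ℝ), ∫ t, w t * deriv η t ∂(intervalMeasure l) =
      -∫ t, G t * η t ∂(intervalMeasure l)) :
    ∀ᵐ t ∂(intervalMeasure l), w t = (∫ s, w s * ρ s ∂(intervalMeasure l)) +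
      ∫ s, G s * meanKernel ρ t s ∂(intervalMeasure l) := by
  set c₀ := ∫ s, w s * ρ s ∂(intervalMeasure l)
  have hK : Integrable (fun p : ℝ × ℝ => G p.2 * meanKernel ρ p.1 p.2)
      ((intervalMeasure l).prod (intervalMeasure l)) := by
    have hG' : Integrable (fun p : ℝ × ℝ => G p.2)
      ((intervalMeasure l).prod (intervalMeasure l)) := hG.comp_snd _
    exact hG'.mul_bdd (measurable_meanKernel ρ.integrable_volume).aestronglyMeasurable
      (Filter.Eventually.of_forall fun p => abs_meanKernel_le ρ.integrable_volume p.1 p.2)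
  have hW : Integrable (fun t => c₀ + ∫ s, G s * meanKernel ρ t s ∂(intervalMeasure l))
      (intervalMeasure l) := (integrable_const c₀).add hK.integral_prod_left
  have key : ∀ᵐ t, t ∈ Ioo 0 l →
      w t - (c₀ + ∫ s, G s * meanKernel ρ t s ∂(intervalMeasure l)) = 0 := by
    refine isOpen_Ioo.ae_eq_zero_of_integral_contDiff_smul_eq_zero
      (IntegrableOn.locallyIntegrableOn (hw.sub hW)) ?_
    intro φ hφ hc hs
    let ψ : 𝓓(openInterval l, ℝ) := ⟨φ, by exact_mod_cast hφ, hc, hs⟩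
    -- Since `∫ ρ = 1`, the function `ψ - c ρ` has zero integral and `ψ = c ρ + η'`. Against `w`,
    -- the first term produces `c c₀` and the second is handled by the weak equation.
    set c := ∫ x, ψ x
    have hf0 : ∫ x, (ψ - c • ρ) x = 0 := by
      have : ∫ x, (ψ - c • ρ) x = ∫ x, (ψ x - c * ρ x) := rfl
      rw [this, integral_sub ψ.integrable_volume (ρ.integrable_volume.const_mul c),
        integral_const_mul, hρ]
      simp [c]
    obtain ⟨η, hη, hη'⟩ := (ψ - c • ρ).exists_primitive hl hf0
    have hbd : ∃ C, ∀ x, ‖ψ x‖ ≤ C := ψ.continuous.bounded_above_of_compact_support hc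
    obtain ⟨C, hC⟩ := hbd
    have ψm : AEStronglyMeasurable ψ (intervalMeasure l) := ψ.continuous.aestronglyMeasurable
    -- As a function of `t`, the indicator `1_{s > t}` is that of `t < s`; integrating against `ψ`
    -- gives `c ∫_{r ≤ s} ρ - ∫_{r ≤ s} ψ = -η(s)`. The kernel thus inverts the derivative.
    have hη2 : ∀ s, ∫ t, meanKernel ρ t s * ψ t ∂(intervalMeasure l) = - η s := by
      intro s
      have e1 : ∀ t, meanKernel ρ t s * ψ t =
          (∫ r in Iic s, ρ r) * ψ t - (Iio s).indicator ψ t := by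
        intro t
        by_cases hts : t < s <;> simp [meanKernel, hts, sub_mul]
      simp_rw [e1]
      rw [integral_sub ((ψ.integrable_volume.restrict).const_mul _)
        ((ψ.integrable_volume.restrict).indicator measurableSet_Iio),
        integral_const_mul, integral_indicator measurableSet_Iio, Measure.restrict_restrict
        measurableSet_Iio, hη]
      have e2 : ∫ t in (openInterval l : Set ℝ), ψ t = c := by
        simpa using ψ.setIntegral_mul (fun _ => 1)
      have e3 : ∫ t in Iio s ∩ openInterval l, ψ t = ∫ t in Iic s, ψ t := by
        rw [integral_Iic_eq_integral_Iio]
        symm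
        exact setIntegral_eq_of_subset_of_forall_sdiff_eq_zero measurableSet_Iio
          inter_subset_left fun x hx => ψ.eq_zero_of_notMem fun h => hx.2 ⟨hx.1, h⟩
      have e4 : ∫ x in Iic s, (ψ - c • ρ) x = (∫ t in Iic s, ψ t) - c * ∫ t in Iic s, ρ t := by
        have : ∫ x in Iic s, (ψ - c • ρ) x = ∫ x in Iic s, (ψ x - c * ρ x) := rfl
        rw [this, integral_sub ψ.integrable_volume.restrict
          (ρ.integrable_volume.restrict.const_mul c), integral_const_mul]
      rw [e2, e3, e4]
      ring
    have hψK : Integrable (fun p : ℝ × ℝ => G p.2 * meanKernel ρ p.1 p.2 * ψ p.1)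
        ((intervalMeasure l).prod (intervalMeasure l)) :=
      hK.mul_bdd (ψ.continuous.comp continuous_fst).aestronglyMeasurable
        (Filter.Eventually.of_forall fun p => hC p.1)
    have e5 : ∫ t, (∫ s, G s * meanKernel ρ t s ∂(intervalMeasure l)) * ψ t
        ∂(intervalMeasure l) = - ∫ s, G s * η s ∂(intervalMeasure l) := by
      simp_rw [← integral_mul_const]
      rw [integral_integral_swap hψK, ← integral_neg]
      refine integral_congr_ae (Filter.Eventually.of_forall fun s => ?_)
      simp only [mul_assoc]
      rw [integral_const_mul, hη2, mul_neg]
    have e6 := h η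
    rw [hη', ← e5] at e6
    have iw : Integrable (fun t => w t * ψ t) (intervalMeasure l) :=
      hw.mul_bdd ψm (Filter.Eventually.of_forall hC)
    have iρ : Integrable (fun t => w t * ρ t) (intervalMeasure l) := by
      obtain ⟨D, hD⟩ := ρ.continuous.bounded_above_of_compact_support ρ.hasCompactSupport
      exact hw.mul_bdd ρ.continuous.aestronglyMeasurable (Filter.Eventually.of_forall hD)
    have e7 : ∫ t, w t * (ψ - c • ρ) t ∂(intervalMeasure l) =
        ∫ t, w t * ψ t ∂(intervalMeasure l) - c * c₀ := by
      rw [← integral_const_mul, ← integral_sub iw (iρ.const_mul c)]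
      refine integral_congr_ae (Filter.Eventually.of_forall fun t => ?_)
      change w t * (ψ t - c * ρ t) = _
      ring
    have e2 : ∫ t in (openInterval l : Set ℝ), ψ t = c := by
      simpa using ψ.setIntegral_mul (fun _ => 1)
    have iKψ : Integrable (fun t => (∫ s, G s * meanKernel ρ t s ∂(intervalMeasure l)) * ψ t)
      (intervalMeasure l) :=
      hK.integral_prod_left.mul_bdd ψm (Filter.Eventually.of_forall hC)
    have e8 : ∀ t, φ t • (w t - (c₀ + ∫ s, G s * meanKernel ρ t s ∂(intervalMeasure l))) =
        (w t - (c₀ + ∫ s, G s * meanKernel ρ t s ∂(intervalMeasure l))) * ψ t := by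
      intro t
      rw [smul_eq_mul, mul_comm]; rfl
    simp_rw [e8]
    rw [← ψ.setIntegral_mul]
    have e9 : ∀ t, (w t - (c₀ + ∫ s, G s * meanKernel ρ t s ∂(intervalMeasure l))) * ψ t =
        w t * ψ t - (c₀ * ψ t +
          (∫ s, G s * meanKernel ρ t s ∂(intervalMeasure l)) * ψ t) := by
      intro t; ring
    simp_rw [e9]
    have i9 := (ψ.integrable_volume.restrict (s := openInterval l)).const_mul c₀
    have i10 : Integrable (fun t => c₀ * ψ t +
        (∫ s, G s * meanKernel ρ t s ∂(intervalMeasure l)) * ψ t) (intervalMeasure l) :=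
      i9.add iKψ
    rw [integral_sub iw i10, integral_add i9 iKψ, integral_const_mul, e2,
      ← e6, e7]
    ring
  refine (ae_restrict_iff' isOpen_Ioo.measurableSet).2 ?_
  filter_upwards [key] with t ht htm
  exact sub_eq_zero.1 (ht htm)

/-! ### Tensor products and slices in `L²` of a product -/

theorem norm_sq_Lp_two {γ : Type*} [MeasurableSpace γ] {π : Measure γ} (h : Lp ℝ 2 π) :
    ‖h‖ ^ 2 = ∫ x, (h x) ^ 2 ∂π := by
  rw [← real_inner_self_eq_norm_sq, L2.inner_def]
  simp [sq]

theorem memLp_two_mul_prod {α β : Type*} [MeasurableSpace α] [MeasurableSpace β]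
    {μ : Measure α} {ν : Measure β} {f : α → ℝ} {g : β → ℝ} (hf : MemLp f 2 μ) (hg : MemLp g 2 ν) :
    MemLp (fun p : α × β => f p.1 * g p.2) 2 (μ.prod ν) := by
  refine (memLp_two_iff_integrable_sq (hf.1.comp_fst.mul hg.1.comp_snd)).2 ?_
  refine (integrable_congr (Filter.Eventually.of_forall fun p => mul_pow _ _ 2)).2 ?_
  exact hf.integrable_sq.mul_prod hg.integrable_sq

theorem integrable_slicePairing {α β : Type*} [MeasurableSpace α] [MeasurableSpace β]
    {μ : Measure α} {ν : Measure β} (F : Lp ℝ 2 (μ.prod ν)) {k : α → ℝ} {u : β → ℝ}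
    (hk : MemLp k 2 μ) (hu : MemLp u 2 ν) :
    Integrable (fun p : α × β => F p * (k p.1 * u p.2)) (μ.prod ν) :=
  (Lp.memLp F).integrable_mul (memLp_two_mul_prod hk hu)

section Tensor

variable {α β : Type*} [MeasurableSpace α] [MeasurableSpace β] {μ : Measure α} {ν : Measure β}
  [SFinite μ] [SFinite ν]

variable (μ ν) in
/-- The tensor product `(f, g) ↦ ((x, y) ↦ f x * g y)` as a bounded bilinear map on `L²`. -/
def tensorL : Lp ℝ 2 μ →L[ℝ] Lp ℝ 2 ν →L[ℝ] Lp ℝ 2 (μ.prod ν) :=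
  LinearMap.mkContinuous₂
    (LinearMap.mk₂ ℝ (fun f g => (memLp_two_mul_prod (Lp.memLp f) (Lp.memLp g)).toLp)
      (fun f f' g => by
        rw [← MemLp.toLp_add]
        refine MemLp.toLp_congr _ _ ?_
        filter_upwards [Measure.quasiMeasurePreserving_fst.ae (Lp.coeFn_add f f')] with p hp
        rw [Pi.add_apply, hp, Pi.add_apply, add_mul])
      (fun c f g => by
        rw [← MemLp.toLp_const_smul]
        refine MemLp.toLp_congr _ _ ?_
        filter_upwards [Measure.quasiMeasurePreserving_fst.ae (Lp.coeFn_smul c f)] with p hp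
        simp [hp, mul_assoc])
      (fun f g g' => by
        rw [← MemLp.toLp_add]
        refine MemLp.toLp_congr _ _ ?_
        filter_upwards [Measure.quasiMeasurePreserving_snd.ae (Lp.coeFn_add g g')] with p hp
        rw [Pi.add_apply, hp, Pi.add_apply, mul_add])
      (fun c f g => by
        rw [← MemLp.toLp_const_smul]
        refine MemLp.toLp_congr _ _ ?_
        filter_upwards [Measure.quasiMeasurePreserving_snd.ae (Lp.coeFn_smul c g)] with p hp
        simp [hp, mul_left_comm]))
    -- Fubini gives `‖f ⊗ g‖ = ‖f‖ ‖g‖`, whence the constant `1`.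
    1 (fun f g => by
      change ‖(memLp_two_mul_prod (Lp.memLp f) (Lp.memLp g)).toLp‖ ≤ _
      rw [one_mul]
      refine (sq_le_sq₀ (norm_nonneg _) (by positivity)).1 ?_
      rw [mul_pow, norm_sq_Lp_two f, norm_sq_Lp_two g, norm_sq_Lp_two,
        ← integral_prod_mul (μ := μ) (ν := ν)]
      refine le_of_eq (integral_congr_ae ?_)
      filter_upwards [MemLp.coeFn_toLp (memLp_two_mul_prod (Lp.memLp f) (Lp.memLp g))] with p hp
      rw [hp, mul_pow])

theorem coeFn_tensorL (f : Lp ℝ 2 μ) (g : Lp ℝ 2 ν) :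
    tensorL μ ν f g =ᵐ[μ.prod ν] fun p => f p.1 * g p.2 :=
  MemLp.coeFn_toLp (memLp_two_mul_prod (Lp.memLp f) (Lp.memLp g))

variable (μ ν) in
/-- The trilinear form `(k, F, u) ↦ ∫ F(t, x) k(t) u(x)`. -/
def slicePairing : Lp ℝ 2 μ →L[ℝ] Lp ℝ 2 (μ.prod ν) →L[ℝ] StrongDual ℝ (Lp ℝ 2 ν) :=
  (((ContinuousLinearMap.compL ℝ (Lp ℝ 2 (μ.prod ν)) (StrongDual ℝ (Lp ℝ 2 (μ.prod ν)))
    (StrongDual ℝ (Lp ℝ 2 ν))).flip (innerSL ℝ)).comp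
      (ContinuousLinearMap.compL ℝ (Lp ℝ 2 ν) (Lp ℝ 2 (μ.prod ν)) ℝ).flip).comp (tensorL μ ν)

theorem slicePairing_apply (k : Lp ℝ 2 μ) (F : Lp ℝ 2 (μ.prod ν)) (u : Lp ℝ 2 ν) :
    slicePairing μ ν k F u = ∫ p, F p * (k p.1 * u p.2) ∂(μ.prod ν) := by
  change inner ℝ F (tensorL μ ν k u) = _
  rw [L2.inner_def]
  refine integral_congr_ae ?_
  filter_upwards [coeFn_tensorL k u] with p hp
  simp [hp, mul_comm]

/-- Fubini puts the pairing in the form of the one-dimensional formula. Pointwise representatives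
are allowed because `k₀` will be `ρ` or the kernel, and `u₀` a test function or its derivative. -/
theorem slicePairing_eq_iterated {k₀ : α → ℝ} {u₀ : β → ℝ} (F : Lp ℝ 2 (μ.prod ν))
    (k : Lp ℝ 2 μ) (u : Lp ℝ 2 ν) (hk : k =ᵐ[μ] k₀) (hu : u =ᵐ[ν] u₀) :
    slicePairing μ ν k F u = ∫ t, (∫ x, F (t, x) * u₀ x ∂ν) * k₀ t ∂μ := by
  rw [slicePairing_apply, integral_prod _
    (integrable_slicePairing F (Lp.memLp k) (Lp.memLp u))]
  refine integral_congr_ae ?_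
  filter_upwards [hk] with t ht
  rw [← integral_mul_const]
  refine integral_congr_ae ?_
  filter_upwards [hu] with x hx
  rw [ht, hx]
  ring

theorem ae_memLp_two_slice (F : Lp ℝ 2 (μ.prod ν)) :
    ∀ᵐ t ∂μ, MemLp (fun x => F (t, x)) 2 ν := by
  have h := (Lp.memLp F).integrable_sq
  filter_upwards [h.prod_right_ae, (Lp.memLp F).1.prodMk_left] with t h1 h2
  exact (memLp_two_iff_integrable_sq h2).2 h1

end Tensor

/-! ### The kernel as a continuous curve in `L²` -/

theorem memLp_integral_Iic {l : ℝ} {ρ : ℝ → ℝ} (hρ : Integrable ρ) :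
    MemLp (fun s => ∫ r in Iic s, ρ r) 2 (intervalMeasure l) := by
  refine MemLp.of_bound (continuous_integral_Iic hρ).aestronglyMeasurable (∫ r, |ρ r|)
    (Filter.Eventually.of_forall fun s => ?_)
  exact (abs_integral_le_integral_abs).trans
    (setIntegral_le_integral hρ.abs (Filter.Eventually.of_forall fun _ => abs_nonneg _))

/-- The kernel `K_t` as an element of `L²(0, l)`. -/
def meanKernelLp (l : ℝ) {ρ : ℝ → ℝ} (hρ : Integrable ρ) (t : ℝ) : Lp ℝ 2 (intervalMeasure l) :=
  (memLp_integral_Iic hρ).toLp - indicatorConstLp 2 (measurableSet_Ioi (a := t))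
    (measure_ne_top _ _) (1 : ℝ)

theorem coeFn_meanKernelLp {l : ℝ} {ρ : ℝ → ℝ} (hρ : Integrable ρ) (t : ℝ) :
    meanKernelLp l hρ t =ᵐ[intervalMeasure l] meanKernel ρ t := by
  filter_upwards [Lp.coeFn_sub (memLp_integral_Iic (l := l) hρ).toLp (indicatorConstLp 2
    (measurableSet_Ioi (a := t)) (measure_ne_top (intervalMeasure l) _) (1 : ℝ)),
    MemLp.coeFn_toLp (memLp_integral_Iic (l := l) hρ), indicatorConstLp_coeFn (p := 2)
    (hs := measurableSet_Ioi (a := t)) (hμs := measure_ne_top (intervalMeasure l) _) (c := (1 : ℝ))]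
    with s h1 h2 h3
  rw [meanKernelLp, h1, Pi.sub_apply, h2, h3]
  rfl

/-- Only the indicator depends on `t`, and the half-lines `s > y` and `s > t` differ on a set of
measure at most `|y - t|`. All continuity in time of the traces comes from here. -/
theorem continuous_meanKernelLp {l : ℝ} {ρ : ℝ → ℝ} (hρ : Integrable ρ) :
    Continuous (meanKernelLp l hρ) := by
  refine continuous_const.sub (continuous_indicatorConstLp_set (by norm_num) fun t => ?_)
  have h : ∀ y, intervalMeasure l (symmDiff (Ioi y) (Ioi t)) ≤ ENNReal.ofReal |y - t| := by
    intro y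
    refine (Measure.restrict_apply_le _ _).trans ?_
    refine (measure_mono (t := uIoc y t) ?_).trans ?_
    · intro s hs
      rw [mem_symmDiff] at hs
      rw [mem_uIoc]
      simp only [mem_Ioi, not_lt] at hs
      tauto
    · rw [Real.volume_uIoc, abs_sub_comm]
  refine tendsto_of_tendsto_of_tendsto_of_le_of_le tendsto_const_nhds ?_ (fun _ => zero_le) h
  have : Continuous fun y : ℝ => ENNReal.ofReal |y - t| :=
    ENNReal.continuous_ofReal.comp (by fun_prop)
  simpa using this.tendsto t

/-! ### Evolution equations and functionals on `H¹₀` -/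

/-- Lebesgue measure on `(0, l) × (0, L)`, as a product measure. -/
abbrev cylMeasure (l L : ℝ) : Measure (ℝ × ℝ) := (intervalMeasure l).prod (intervalMeasure L)

/-- `∂ₜ θ = a - ∂ₓ b` on `(0, l) × (0, L)`, tested on products of test functions. -/
def IsWeakEvolution (l L : ℝ) (θ a b : ℝ × ℝ → ℝ) : Prop :=
  ∀ (η : 𝓓(openInterval l, ℝ)) (u : 𝓓(openInterval L, ℝ)),
    ∫ p, θ p * (deriv η p.1 * u p.2) ∂(cylMeasure l L) =
      -∫ p, (a p * (η p.1 * u p.2) + b p * (η p.1 * deriv u p.2)) ∂(cylMeasure l L)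

/-- The inclusion `H¹₀(0, L) → L²(0, L)`. -/
def H10fst (L : ℝ) : H10 L →L[ℝ] Lp ℝ 2 (intervalMeasure L) :=
  (WithLp.fstL 2 ℝ (Lp ℝ 2 (intervalMeasure L)) (Lp ℝ 2 (intervalMeasure L))).comp
    (H10 L).subtypeL

/-- The derivative `H¹₀(0, L) → L²(0, L)`. -/
def H10snd (L : ℝ) : H10 L →L[ℝ] Lp ℝ 2 (intervalMeasure L) :=
  (WithLp.sndL 2 ℝ (Lp ℝ 2 (intervalMeasure L)) (Lp ℝ 2 (intervalMeasure L))).comp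
    (H10 L).subtypeL

/-- The functional `u ↦ ∫ F(t, x) k(t) u(x)` of `u ∈ H¹₀(0, L)`. -/
def pairFst (l L : ℝ) (k : Lp ℝ 2 (intervalMeasure l)) :
    Lp ℝ 2 (cylMeasure l L) →L[ℝ] HMinusOne L :=
  (ContinuousLinearMap.precomp ℝ (H10fst L)).comp
    (slicePairing (intervalMeasure l) (intervalMeasure L) k)

/-- The functional `u ↦ ∫ F(t, x) k(t) u'(x)` of `u ∈ H¹₀(0, L)`. -/
def pairSnd (l L : ℝ) (k : Lp ℝ 2 (intervalMeasure l)) :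
    Lp ℝ 2 (cylMeasure l L) →L[ℝ] HMinusOne L :=
  (ContinuousLinearMap.precomp ℝ (H10snd L)).comp
    (slicePairing (intervalMeasure l) (intervalMeasure L) k)

theorem continuous_pairFst {l L : ℝ} (F : Lp ℝ 2 (cylMeasure l L)) :
    Continuous fun k => pairFst l L k F :=
  (ContinuousLinearMap.precomp ℝ (H10fst L)).continuous.comp
    (((slicePairing (intervalMeasure l) (intervalMeasure L)).flip F).continuous)

theorem continuous_pairSnd {l L : ℝ} (F : Lp ℝ 2 (cylMeasure l L)) :
    Continuous fun k => pairSnd l L k F :=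
  (ContinuousLinearMap.precomp ℝ (H10snd L)).continuous.comp
    (((slicePairing (intervalMeasure l) (intervalMeasure L)).flip F).continuous)

/-- A property of a.e. `t` that holds for each test jet holds for a.e. `t` on all of `H¹₀`, if it is
an equality between continuous functionals. -/
theorem ae_eq_of_forall_testJets {L : ℝ} {m : Measure ℝ} {S R : ℝ → HMinusOne L}
    (h : ∀ u : H10 L, u.1 ∈ testJets L → ∀ᵐ t ∂m, S t u = R t u) : ∀ᵐ t ∂m, S t = R t := by
  have : Fact ((2 : ℝ≥0∞) ≠ ∞) := ⟨by norm_num⟩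
  have : SecondCountableTopology
      (WithLp 2 (Lp ℝ 2 (intervalMeasure L) × Lp ℝ 2 (intervalMeasure L))) :=
    (WithLp.prodContinuousLinearEquiv 2 ℝ _ _).toHomeomorph.secondCountableTopology
  -- The null set of times depends on `u`. Separability leaves countably many `u`, whose null sets
  -- can be united.
  obtain ⟨c, hcs, hc, hd⟩ := (IsSeparable.of_separableSpace
    {u : H10 L | u.1 ∈ testJets L}).exists_countable_dense_subset
  have hdense : Dense {u : H10 L | u.1 ∈ testJets L} := by
    intro u
    rw [closure_subtype]
    have := u.2
    rw [← SetLike.mem_coe, Submodule.topologicalClosure_coe] at this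
    refine closure_mono ?_ this
    intro v hv
    exact ⟨⟨v, subset_closure hv⟩, hv, rfl⟩
  have hcd : Dense c := fun u => closure_minimal hd isClosed_closure (hdense u)
  filter_upwards [(ae_ball_iff hc).2 fun u hu => h u (hcs hu)] with t ht
  exact ContinuousLinearMap.coeFn_injective
    (Continuous.ext_on hcd (S t).continuous (R t).continuous ht)

/-- The functional on `H¹₀` represented by `f`. -/
def l2Functional (L : ℝ) (f : Lp ℝ 2 (intervalMeasure L)) : HMinusOne L :=
  (innerSL ℝ f).comp (H10fst L)

theorem l2Functional_apply {L : ℝ} {f : ℝ → ℝ} (hf : MemLp f 2 (intervalMeasure L)) (u : H10 L) :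
    l2Functional L hf.toLp u = ∫ t, f t * u.1.fst t ∂(intervalMeasure L) := by
  change inner ℝ hf.toLp u.1.fst = _
  rw [L2.inner_def]
  refine integral_congr_ae ?_
  filter_upwards [hf.coeFn_toLp] with t ht
  simp [ht, mul_comm]

/-! ### The trace family of an evolution equation -/

section Reconstruction

variable {l L : ℝ} {X : Type*} [NormedAddCommGroup X] [NormedSpace ℝ X]

/-- The trace at time `t` of a solution of `∂ₜ θ = a - ∂ₓ b`. -/
def traceOp (ρ : 𝓓(openInterval l, ℝ)) (θ a b : X →L[ℝ] Lp ℝ 2 (cylMeasure l L)) (t : ℝ) :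
    X →L[ℝ] HMinusOne L :=
  (pairFst l L (ρ.continuous.memLp_of_hasCompactSupport ρ.hasCompactSupport).toLp).comp θ +
    (pairFst l L (meanKernelLp l ρ.integrable_volume t)).comp a +
    (pairSnd l L (meanKernelLp l ρ.integrable_volume t)).comp b

theorem continuous_traceOp (ρ : 𝓓(openInterval l, ℝ))
    (θ a b : X →L[ℝ] Lp ℝ 2 (cylMeasure l L)) (w : X) :
    Continuous fun t => traceOp ρ θ a b t w :=
  (continuous_const.add ((continuous_pairFst (a w)).comp (continuous_meanKernelLp _))).add
    ((continuous_pairSnd (b w)).comp (continuous_meanKernelLp _))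

/-- Testing the equation on products `η(t) φ(x)` shows that `t ↦ ∫ θ(t,x) φ(x) dx` has weak
derivative `∫ a φ + ∫ b φ'`. The reconstruction formula for this scalar function is `traceOp`
evaluated at `φ`; density of the test functions in `H¹₀` does the rest. -/
theorem ae_isRepresentedBy_traceOp (hl : 0 < l) (ρ : 𝓓(openInterval l, ℝ)) (hρ : ∫ x, ρ x = 1)
    (θ a b : X →L[ℝ] Lp ℝ 2 (cylMeasure l L)) (w : X)
    (h : IsWeakEvolution l L (θ w) (a w) (b w)) :
    ∀ᵐ t ∂(intervalMeasure l), IsRepresentedBy (traceOp ρ θ a b t w) (fun x => θ w (t, x)) := by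
  classical
  -- Slices are square integrable only for a.e. `t`; the default `0` is used on a null set of times
  -- only.
  let R : ℝ → HMinusOne L := fun t =>
    if ht : MemLp (fun x => θ w (t, x)) 2 (intervalMeasure L) then l2Functional L ht.toLp else 0
  have key : ∀ᵐ t ∂(intervalMeasure l), traceOp ρ θ a b t w = R t := by
    refine ae_eq_of_forall_testJets ?_
    rintro u ⟨φ, hφ1, hφ2⟩
    have mφ : MemLp φ 2 (intervalMeasure L) :=
      φ.continuous.memLp_of_hasCompactSupport φ.hasCompactSupport
    have mφ' : MemLp (deriv φ) 2 (intervalMeasure L) :=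
      (φ.contDiff.continuous_deriv (by simp)).memLp_of_hasCompactSupport φ.hasCompactSupport.deriv
    have mη : ∀ η : 𝓓(openInterval l, ℝ), MemLp η 2 (intervalMeasure l) := fun η =>
      η.continuous.memLp_of_hasCompactSupport η.hasCompactSupport
    have mη' : ∀ η : 𝓓(openInterval l, ℝ), MemLp (deriv η) 2 (intervalMeasure l) := fun η =>
      (η.contDiff.continuous_deriv (by simp)).memLp_of_hasCompactSupport η.hasCompactSupport.deriv
    have m1 : MemLp (fun _ : ℝ => (1 : ℝ)) 2 (intervalMeasure l) := memLp_const 1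
    have int : ∀ (F : Lp ℝ 2 (cylMeasure l L)) {ψ : ℝ → ℝ}, MemLp ψ 2 (intervalMeasure L) →
        Integrable (fun p : ℝ × ℝ => F p * ψ p.2) (cylMeasure l L) := by
      intro F ψ hψ
      simpa using integrable_slicePairing F m1 hψ
    have iθ := int (θ w) mφ
    have ia := int (a w) mφ
    have ib := int (b w) mφ'
    have hw : Integrable (fun t => ∫ x, θ w (t, x) * φ x ∂(intervalMeasure L))
      (intervalMeasure l) := iθ.integral_prod_left
    have hA : Integrable (fun t => ∫ x, a w (t, x) * φ x ∂(intervalMeasure L))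
      (intervalMeasure l) := ia.integral_prod_left
    have hB : Integrable (fun t => ∫ x, b w (t, x) * deriv φ x ∂(intervalMeasure L))
      (intervalMeasure l) := ib.integral_prod_left
    have iter : ∀ (F : Lp ℝ 2 (cylMeasure l L)) {k ψ : ℝ → ℝ}, MemLp k 2 (intervalMeasure l) →
        MemLp ψ 2 (intervalMeasure L) → ∫ p, F p * (k p.1 * ψ p.2) ∂(cylMeasure l L) =
        ∫ t, (∫ x, F (t, x) * ψ x ∂(intervalMeasure L)) * k t ∂(intervalMeasure l) := by
      intro F k ψ hk hψ
      rw [integral_prod _ (integrable_slicePairing F hk hψ)]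
      refine integral_congr_ae (Filter.Eventually.of_forall fun t => ?_)
      simp only
      rw [← integral_mul_const]
      refine integral_congr_ae (Filter.Eventually.of_forall fun x => ?_)
      simp only
      ring
    have bddmul : ∀ {G : ℝ → ℝ} (η : 𝓓(openInterval l, ℝ)), Integrable G (intervalMeasure l) →
        Integrable (fun t => G t * η t) (intervalMeasure l) := by
      intro G η hG
      obtain ⟨C, hC⟩ := η.continuous.bounded_above_of_compact_support η.hasCompactSupport
      exact hG.mul_bdd η.continuous.aestronglyMeasurable (Filter.Eventually.of_forall hC)
    have weak := ae_eq_of_weak_deriv hl ρ hρ hw (hA.add hB) (fun η => by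
      have := h η φ
      rw [integral_add (integrable_slicePairing (a w) (mη η) mφ)
        (integrable_slicePairing (b w) (mη η) mφ'), iter _ (mη' η) mφ, iter _ (mη η) mφ,
        iter _ (mη η) mφ'] at this
      rw [this, ← integral_add (bddmul η hA) (bddmul η hB)]
      simp only [Pi.add_apply, add_mul])
    filter_upwards [weak, ae_memLp_two_slice (θ w)] with t ht hm
    have e1 : R t u = ∫ x, θ w (t, x) * φ x ∂(intervalMeasure L) := by
      simp only [R, dif_pos hm]
      rw [l2Functional_apply]
      refine integral_congr_ae ?_
      filter_upwards [hφ1] with x hx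
      rw [hx]
    have e2 : traceOp ρ θ a b t w u =
        (∫ s, (∫ x, θ w (s, x) * φ x ∂(intervalMeasure L)) * ρ s ∂(intervalMeasure l)) +
        (∫ s, (∫ x, a w (s, x) * φ x ∂(intervalMeasure L)) * meanKernel ρ t s
          ∂(intervalMeasure l)) +
        ∫ s, (∫ x, b w (s, x) * deriv φ x ∂(intervalMeasure L)) * meanKernel ρ t s
          ∂(intervalMeasure l) := by
      rw [← slicePairing_eq_iterated (θ w) _ u.1.fst (mη ρ).coeFn_toLp hφ1,
        ← slicePairing_eq_iterated (a w) _ u.1.fst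
          (coeFn_meanKernelLp ρ.integrable_volume t) hφ1,
        ← slicePairing_eq_iterated (b w) _ u.1.snd
          (coeFn_meanKernelLp ρ.integrable_volume t) hφ2]
      rfl
    have bK : ∀ {G : ℝ → ℝ}, Integrable G (intervalMeasure l) →
        Integrable (fun s => G s * meanKernel ρ t s) (intervalMeasure l) := fun hG =>
      hG.mul_bdd ((measurable_meanKernel ρ.integrable_volume).comp
        measurable_prodMk_left).aestronglyMeasurable (Filter.Eventually.of_forall fun s =>
          abs_meanKernel_le ρ.integrable_volume t s)
    rw [e1, e2, ht, add_assoc, ← integral_add (bK hA) (bK hB)]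
    simp only [Pi.add_apply, add_mul]
  filter_upwards [key, ae_memLp_two_slice (θ w)] with t ht hm
  refine ⟨hm, fun u => ?_⟩
  rw [ht]
  simp only [R, dif_pos hm]
  exact l2Functional_apply hm u

end Reconstruction

/-! ### Mollification and weak derivatives -/

section Mollify

open Filter Topology
open scoped Convolution

/-- A bump function supported in the ball of radius `2 / (n + 1)`. -/
def mollBump (E : Type*) [NormedAddCommGroup E] (n : ℕ) : ContDiffBump (0 : E) :=
  ⟨1 / (n + 1), 2 / (n + 1), by positivity, by gcongr; norm_num⟩

theorem tendsto_rOut_mollBump {E : Type*} [NormedAddCommGroup E] :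
    Tendsto (fun n => (mollBump E n).rOut) atTop (𝓝 0) := by
  have : Tendsto (fun n : ℕ => 2 * (1 / ((n : ℝ) + 1))) atTop (𝓝 (2 * 0)) :=
    tendsto_one_div_add_atTop_nhds_zero_nat.const_mul 2
  rw [mul_zero] at this
  refine this.congr fun n => ?_
  change _ = 2 / ((n : ℝ) + 1)
  ring

variable {E : Type*} [NormedAddCommGroup E] [NormedSpace ℝ E] [FiniteDimensional ℝ E]
  [MeasureSpace E] [BorelSpace E] [(volume : Measure E).IsAddHaarMeasure]

/-- The mollification of a function at scale `2 / (n + 1)`. -/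
def mollify (n : ℕ) (f : E → ℝ) : E → ℝ :=
  (mollBump E n).normed volume ⋆[ContinuousLinearMap.lsmul ℝ ℝ, volume] f

theorem mollify_apply (n : ℕ) (f : E → ℝ) (p : E) :
    mollify n f p = ∫ t, (mollBump E n).normed volume (p - t) * f t := by
  rw [mollify, convolution_eq_swap]
  rfl

theorem contDiff_mollify (n : ℕ) {f : E → ℝ} (hf : LocallyIntegrable f) :
    ContDiff ℝ (⊤ : ℕ∞) (mollify n f) :=
  (mollBump E n).hasCompactSupport_normed.contDiff_convolution_left _
    (mollBump E n).contDiff_normed hf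

/-- This is Lebesgue differentiation: the outer radius is at most twice the inner one, so the
kernels are comparable to ball averages. -/
theorem ae_tendsto_mollify {f : E → ℝ} (hf : LocallyIntegrable f) :
    ∀ᵐ p, Tendsto (fun n => mollify n f p) atTop (𝓝 (f p)) := by
  refine ContDiffBump.ae_convolution_tendsto_right_of_locallyIntegrable (K := 2)
    tendsto_rOut_mollBump (Eventually.of_forall fun n => ?_) hf
  change 2 / ((n : ℝ) + 1) ≤ 2 * (1 / (n + 1))
  exact le_of_eq (by ring)

theorem integral_normed_sub_left (n : ℕ) (p : E) :
    ∫ t, (mollBump E n).normed volume (p - t) = 1 := by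
  rw [integral_sub_left_eq_self (fun t => (mollBump E n).normed volume t)]
  exact (mollBump E n).integral_normed (μ := volume)

theorem integrable_normed_sub_left (n : ℕ) (p : E) :
    Integrable fun t => (mollBump E n).normed volume (p - t) :=
  (mollBump E n).integrable_normed.comp_sub_left p

theorem integrable_mollify (n : ℕ) {f : E → ℝ} (hf : LocallyIntegrable f) (p : E) :
    Integrable fun t => (mollBump E n).normed volume (p - t) * f t := by
  have := ((mollBump E n).hasCompactSupport_normed (μ := volume)).convolutionExists_left
    (ContinuousLinearMap.lsmul ℝ ℝ) (mollBump E n).continuous_normed hf p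
  simpa using this.integrable_swap

/-- The kernel is a probability density, so bounds survive mollification. The lower bound on `λ`
thus passes to every `λ_n`, and `1/λ_n` stays bounded uniformly in `n`. -/
theorem le_mollify (n : ℕ) {f : E → ℝ} (hf : LocallyIntegrable f) {c : ℝ} (h : ∀ t, c ≤ f t)
    (p : E) : c ≤ mollify n f p := by
  rw [mollify_apply]
  calc c = ∫ t, (mollBump E n).normed volume (p - t) * c := by
        rw [integral_mul_const, integral_normed_sub_left, one_mul]
    _ ≤ _ := integral_mono ((integrable_normed_sub_left n p).mul_const c)
        (integrable_mollify n hf p)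
        fun t => mul_le_mul_of_nonneg_left (h t) ((mollBump E n).nonneg_normed _)

theorem mollify_le (n : ℕ) {f : E → ℝ} (hf : LocallyIntegrable f) {c : ℝ} (h : ∀ t, f t ≤ c)
    (p : E) : mollify n f p ≤ c := by
  rw [mollify_apply]
  calc _ ≤ ∫ t, (mollBump E n).normed volume (p - t) * c :=
        integral_mono (integrable_mollify n hf p) ((integrable_normed_sub_left n p).mul_const c)
          fun t => mul_le_mul_of_nonneg_left (h t) ((mollBump E n).nonneg_normed _)
    _ = c := by rw [integral_mul_const, integral_normed_sub_left, one_mul]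

theorem fderiv_mollify_apply (n : ℕ) {f : E → ℝ} (hf : LocallyIntegrable f) (p v : E) :
    fderiv ℝ (mollify n f) p v =
      ∫ t, f t * fderiv ℝ ((mollBump E n).normed volume) (p - t) v := by
  have hd := (mollBump E n).hasCompactSupport_normed.hasFDerivAt_convolution_left
    (ContinuousLinearMap.lsmul ℝ ℝ) ((mollBump E n).contDiff_normed (μ := volume) (n := 1)) hf p
  have hex := ((mollBump E n).hasCompactSupport_normed (μ := volume)).fderiv ℝ
    |>.convolutionExists_left ((ContinuousLinearMap.lsmul ℝ ℝ : ℝ →L[ℝ] ℝ →L[ℝ] ℝ).precompL E)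
      (((mollBump E n).contDiff_normed (n := 1)).continuous_fderiv (by simp)) hf p
  rw [mollify, hd.fderiv, convolution_eq_swap,
    ContinuousLinearMap.integral_apply hex.integrable_swap]
  refine integral_congr_ae (Eventually.of_forall fun t => ?_)
  simp [ContinuousLinearMap.precompL_apply, mul_comm]

end Mollify

open Filter Topology in
/-- On compact subsets of `U`, the derivative of the mollification is the mollification of the weak
derivative. -/
theorem IsWeakPartial.eventually_fderiv_mollify {U : Opens (ℝ × ℝ)} {v : ℝ × ℝ}
    {f d : ℝ × ℝ → ℝ} (h : IsWeakPartial U v f d) (hf : LocallyIntegrable f)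
    (hd0 : ∀ p, p ∉ (U : Set (ℝ × ℝ)) → d p = 0)
    {K : Set (ℝ × ℝ)} (hK : IsCompact K) (hKU : K ⊆ U) :
    ∀ᶠ n in atTop, ∀ p ∈ K, fderiv ℝ (mollify n f) p v = mollify n d p := by
  -- Once the bump radius is below `δ`, the function `t ↦ ρ(p - t)` is a test function on `U` for
  -- every `p ∈ K`; its chain-rule sign cancels the sign in the weak derivative.
  obtain ⟨δ, hδ, hδU⟩ := hK.exists_cthickening_subset_open U.isOpen hKU
  filter_upwards [(tendsto_rOut_mollBump (E := ℝ × ℝ)).eventually (gt_mem_nhds hδ)] with n hn p hp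
  set ρ := (mollBump (ℝ × ℝ) n).normed volume
  have hsub : ∀ t, p - t ∈ tsupport ρ → t ∈ (U : Set (ℝ × ℝ)) := by
    intro t ht
    rw [ContDiffBump.tsupport_normed_eq, Metric.mem_closedBall, dist_zero_right,
      ← dist_eq_norm, dist_comm] at ht
    exact hδU (Metric.mem_cthickening_of_dist_le t p δ K hp (ht.trans hn.le))
  have hts : tsupport (fun t => ρ (p - t)) ⊆ (fun t => p - t) ⁻¹' tsupport ρ :=
    closure_minimal (fun t ht => subset_tsupport _ ht)
      ((isClosed_tsupport _).preimage (by fun_prop))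
  let ψ : 𝓓(U, ℝ) := ⟨fun t => ρ (p - t),
    (mollBump (ℝ × ℝ) n).contDiff_normed.comp (contDiff_const.sub contDiff_id),
    (mollBump (ℝ × ℝ) n).hasCompactSupport_normed.comp_homeomorph (Homeomorph.subLeft p),
    fun t ht => hsub t (hts ht)⟩
  have hψ : ∀ t, fderiv ℝ ψ t v = - fderiv ℝ ρ (p - t) v := by
    intro t
    have h1 : HasFDerivAt ρ (fderiv ℝ ρ (p - t)) (p - t) :=
      ((((mollBump (ℝ × ℝ) n).contDiff_normed (n := 1)).differentiable (by simp)) _).hasFDerivAt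
    have h2 : HasFDerivAt (fun t => p - t) (-ContinuousLinearMap.id ℝ (ℝ × ℝ)) t :=
      (hasFDerivAt_id t).const_sub p
    have h3 : HasFDerivAt ψ _ t := h1.comp t h2
    rw [h3.fderiv]
    simp
  have e := h.2.2 ψ
  rw [fderiv_mollify_apply n hf, mollify_apply]
  simp_rw [hψ, mul_neg, integral_neg, neg_inj] at e
  rw [setIntegral_eq_integral_of_forall_compl_eq_zero,
    setIntegral_eq_integral_of_forall_compl_eq_zero] at e
  · rw [e]
    exact integral_congr_ae (Eventually.of_forall fun t => mul_comm _ _)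
  · intro t ht
    simp [hd0 t ht]
  · intro t ht
    have : fderiv ℝ ρ (p - t) = 0 := by
      refine image_eq_zero_of_notMem_tsupport fun h' => ht (hsub t ?_)
      exact tsupport_fderiv_subset ℝ h'
    simp [this]

/-! ### Testing the transport equation with `φ / λ` -/

theorem rectMeasure_eq_prod (L₁ L₂ : ℝ) : rectMeasure L₁ L₂ = cylMeasure L₁ L₂ :=
  (Measure.prod_restrict _ _).symm

instance isFiniteMeasure_rectMeasure (L₁ L₂ : ℝ) : IsFiniteMeasure (rectMeasure L₁ L₂) := by
  rw [rectMeasure_eq_prod]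
  infer_instance

theorem IsWeakPartial.congr {U : Opens (ℝ × ℝ)} {v : ℝ × ℝ} {f f' g g' : ℝ × ℝ → ℝ}
    (h : IsWeakPartial U v f g) (hf : f =ᵐ[volume.restrict U] f')
    (hg : g =ᵐ[volume.restrict U] g') (hf' : LocallyIntegrable f') (hg' : LocallyIntegrable g') :
    IsWeakPartial U v f' g' := by
  refine ⟨hf'.locallyIntegrableOn _, hg'.locallyIntegrableOn _, fun φ => ?_⟩
  have e1 : ∫ p in U, f' p * fderiv ℝ φ p v = ∫ p in U, f p * fderiv ℝ φ p v := by
    refine integral_congr_ae ?_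
    filter_upwards [hf] with p hp
    rw [hp]
  have e2 : ∫ p in U, g' p * φ p = ∫ p in U, g p * φ p := by
    refine integral_congr_ae ?_
    filter_upwards [hg] with p hp
    rw [hp]
  rw [e1, e2, h.2.2]

theorem locallyIntegrable_of_bounded {E : Type*} [TopologicalSpace E] [MeasurableSpace E]
    {μ : Measure E} [IsLocallyFiniteMeasure μ] {f : E → ℝ}
    (hf : AEStronglyMeasurable f μ) {C : ℝ} (h : ∀ x, |f x| ≤ C) : LocallyIntegrable f μ :=
  (locallyIntegrable_const C).mono hf (Filter.Eventually.of_forall fun x => by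
    rw [Real.norm_eq_abs, Real.norm_eq_abs]
    exact (h x).trans (le_abs_self C))

/-- A function in `L^∞(U)` has a bounded measurable representative vanishing outside `U`. -/
theorem exists_bounded_rep {U : Opens (ℝ × ℝ)} {f : ℝ × ℝ → ℝ}
    (hf : MemLp f ∞ (volume.restrict (U : Set (ℝ × ℝ)))) :
    ∃ (d : ℝ × ℝ → ℝ) (M : ℝ), StronglyMeasurable d ∧ (∀ p, |d p| ≤ M) ∧
      (∀ p, p ∉ (U : Set (ℝ × ℝ)) → d p = 0) ∧ f =ᵐ[volume.restrict U] d := by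
  set m := hf.1.mk f
  set M := (eLpNorm f ∞ (volume.restrict (U : Set (ℝ × ℝ)))).toReal
  have hM : 0 ≤ M := ENNReal.toReal_nonneg
  refine ⟨(U : Set (ℝ × ℝ)).indicator fun p => max (-M) (min M (m p)), M,
    ((stronglyMeasurable_const.sup (stronglyMeasurable_const.inf
      hf.1.stronglyMeasurable_mk)).indicator U.isOpen.measurableSet), fun p => ?_, fun p hp => ?_, ?_⟩
  · by_cases hp : p ∈ (U : Set (ℝ × ℝ))
    · rw [indicator_of_mem hp, abs_le]
      exact ⟨le_max_left _ _, max_le (by linarith) (min_le_left _ _)⟩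
    · rw [indicator_of_notMem hp, abs_zero]
      exact hM
  · exact indicator_of_notMem hp _
  · have hb : ∀ᵐ p ∂(volume.restrict (U : Set (ℝ × ℝ))), ‖f p‖ ≤ M := by
      have h1 := ae_le_eLpNormEssSup (f := f) (μ := volume.restrict (U : Set (ℝ × ℝ)))
      filter_upwards [h1] with p hp
      rw [← eLpNorm_exponent_top] at hp
      have := ENNReal.toReal_mono hf.2.ne hp
      rwa [toReal_enorm] at this
    filter_upwards [hf.1.ae_eq_mk, hb, ae_restrict_mem U.isOpen.measurableSet] with p h1 h2 h3
    rw [indicator_of_mem h3]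
    simp only [m]
    rw [← h1]
    rw [Real.norm_eq_abs, abs_le] at h2
    rw [min_eq_right h2.2, max_eq_right h2.1]

/-- Truncation makes the bounds hold everywhere, also outside `U` where `f` is uncontrolled, as
mollification on the whole plane requires. -/
theorem exists_bounded_rep_between {U : Opens (ℝ × ℝ)} {f : ℝ × ℝ → ℝ}
    (hf : AEStronglyMeasurable f (volume.restrict (U : Set (ℝ × ℝ)))) {c₀ c₁ : ℝ} (h01 : c₀ ≤ c₁)
    (hb : ∀ᵐ p ∂(volume.restrict (U : Set (ℝ × ℝ))), c₀ ≤ f p ∧ f p ≤ c₁) :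
    ∃ d : ℝ × ℝ → ℝ, StronglyMeasurable d ∧ (∀ p, c₀ ≤ d p) ∧ (∀ p, d p ≤ c₁) ∧
      f =ᵐ[volume.restrict U] d := by
  refine ⟨fun p => max c₀ (min c₁ (hf.mk f p)), stronglyMeasurable_const.sup
    (stronglyMeasurable_const.inf hf.stronglyMeasurable_mk), fun p => le_max_left _ _,
    fun p => max_le h01 (min_le_left _ _), ?_⟩
  filter_upwards [hf.ae_eq_mk, hb] with p h1 h2
  rw [← h1, min_eq_right h2.2, max_eq_right h2.1]

theorem PositiveZeroCondition.aestronglyMeasurable {L₁ L₂ : ℝ} {lam : ℝ × ℝ → ℝ}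
    (h : PositiveZeroCondition L₁ L₂ lam) : AEStronglyMeasurable lam (rectMeasure L₁ L₂) := by
  obtain ⟨_, -, hlx⟩ := h.grad_x
  exact hlx.1.aestronglyMeasurable

/-- The quotient of a test function by a smooth function bounded below by a positive constant. -/
def TestFunction.div {U : Opens (ℝ × ℝ)} (φ : 𝓓(U, ℝ)) {f : ℝ × ℝ → ℝ}
    (hf : ContDiff ℝ (⊤ : ℕ∞) f) (h0 : ∀ p, f p ≠ 0) : 𝓓(U, ℝ) where
  toFun p := φ p * (f p)⁻¹
  contDiff' := φ.contDiff.mul (hf.inv h0)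
  hasCompactSupport' := φ.hasCompactSupport.mul_right
  tsupport_subset' := (tsupport_mul_subset_left).trans φ.tsupport_subset

theorem TestFunction.div_apply {U : Opens (ℝ × ℝ)} (φ : 𝓓(U, ℝ)) {f : ℝ × ℝ → ℝ}
    (hf : ContDiff ℝ (⊤ : ℕ∞) f) (h0 : ∀ p, f p ≠ 0) (p : ℝ × ℝ) :
    φ.div hf h0 p = φ p * (f p)⁻¹ := rfl

theorem TestFunction.fderiv_div_apply {U : Opens (ℝ × ℝ)} (φ : 𝓓(U, ℝ)) {f : ℝ × ℝ → ℝ}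
    (hf : ContDiff ℝ (⊤ : ℕ∞) f) (h0 : ∀ p, f p ≠ 0) (p v : ℝ × ℝ) :
    fderiv ℝ (φ.div hf h0) p v =
      fderiv ℝ φ p v * (f p)⁻¹ - φ p * (fderiv ℝ f p v * ((f p)⁻¹ * (f p)⁻¹)) := by
  have h1 : HasFDerivAt φ (fderiv ℝ φ p) p :=
    ((φ.contDiff.differentiable (by simp)) p).hasFDerivAt
  have h2 : HasFDerivAt f (fderiv ℝ f p) p := ((hf.differentiable (by simp)) p).hasFDerivAt
  have h3 : HasFDerivAt (fun q => (f q)⁻¹) _ p :=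
    (hasFDerivAt_inv (h0 p)).comp p h2
  have h4 : HasFDerivAt (φ.div hf h0) _ p := h1.mul h3
  rw [h4.fderiv]
  simp
  ring

open Filter Topology in
theorem tendsto_integral_mul_of_bounded {α : Type*} [MeasurableSpace α] {μ : Measure α}
    {θ : α → ℝ} (hθ : Integrable θ μ) {H : ℕ → α → ℝ} {H₀ : α → ℝ} {C : ℝ}
    (hm : ∀ n, AEStronglyMeasurable (H n) μ) (hb : ∀ᶠ n in atTop, ∀ᵐ x ∂μ, |H n x| ≤ C)
    (hl : ∀ᵐ x ∂μ, Tendsto (fun n => H n x) atTop (𝓝 (H₀ x))) :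
    Tendsto (fun n => ∫ x, θ x * H n x ∂μ) atTop (𝓝 (∫ x, θ x * H₀ x ∂μ)) := by
  refine tendsto_integral_filter_of_dominated_convergence (fun x => |θ x| * C)
    (Eventually.of_forall fun n => hθ.1.mul (hm n)) ?_ (hθ.abs.mul_const C) ?_
  · filter_upwards [hb] with n hn
    filter_upwards [hn] with x hx
    rw [norm_mul, Real.norm_eq_abs, Real.norm_eq_abs]
    gcongr
  · filter_upwards [hl] with x hx
    exact hx.const_mul _

open Filter Topology in
/-- The transport equation may be tested with `φ / λ`. -/
theorem PositiveZeroCondition.integral_div {L₁ L₂ : ℝ} {lam ly θ g : ℝ × ℝ → ℝ}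
    (h : PositiveZeroCondition L₁ L₂ lam) (hly : MemLp ly ∞ (rectMeasure L₁ L₂))
    (hwy : IsWeakPartial (openRect L₁ L₂) (0, 1) lam ly)
    (hθ : Integrable θ (rectMeasure L₁ L₂)) (hg : Integrable g (rectMeasure L₁ L₂))
    (hT : IsTransport L₁ L₂ lam θ g) (φ : 𝓓(openRect L₁ L₂, ℝ)) :
    ∫ p in openRect L₁ L₂, g p * (φ p * (lam p)⁻¹) = -∫ p in openRect L₁ L₂, θ p *
      (fderiv ℝ φ p (1, 0) + fderiv ℝ φ p (0, 1) * (lam p)⁻¹ -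
        φ p * (ly p * ((lam p)⁻¹ * (lam p)⁻¹))) := by
  obtain ⟨c₀, c₁, hc₀, hc₁, hb⟩ := h.bounds
  have hae := h.aestronglyMeasurable
  rcases le_or_gt c₀ c₁ with h01 | h01
  swap
  -- The rectangle may be empty here. If `c₁ < c₀`, the a.e. bounds are contradictory, so the
  -- measure is zero and both sides vanish.
  · have h0 : rectMeasure L₁ L₂ = 0 := by
      rw [← ae_eq_bot, ← empty_mem_iff_bot]
      filter_upwards [hb] with p hp
      linarith [hp.1, hp.2]
    change ∫ p, _ ∂(rectMeasure L₁ L₂) = -∫ p, _ ∂(rectMeasure L₁ L₂)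
    rw [h0]
    simp
  obtain ⟨lx', hlx', hwx'⟩ := h.grad_x
  obtain ⟨lx, hwx, heq⟩ := hT
  have hlx : MemLp lx ∞ (rectMeasure L₁ L₂) := (memLp_congr_ae (hwx'.ae_eq hwx)).1 hlx'
  obtain ⟨m, hm, hm0, hm1, hme⟩ := exists_bounded_rep_between hae h01 hb
  obtain ⟨dx, Mx, hdxm, hdxb, hdx0, hdxe⟩ := exists_bounded_rep hlx
  obtain ⟨dy, My, hdym, hdyb, hdy0, hdye⟩ := exists_bounded_rep hly
  have lm : LocallyIntegrable m := locallyIntegrable_of_bounded (C := c₁)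
    hm.aestronglyMeasurable fun p => by rw [abs_of_nonneg (hc₀.le.trans (hm0 p))]; exact hm1 p
  have ldx : LocallyIntegrable dx := locallyIntegrable_of_bounded hdxm.aestronglyMeasurable hdxb
  have ldy : LocallyIntegrable dy := locallyIntegrable_of_bounded hdym.aestronglyMeasurable hdyb
  have wx := (hwx.congr hme hdxe lm ldx).eventually_fderiv_mollify lm hdx0
    φ.hasCompactSupport φ.tsupport_subset
  have wy := (hwy.congr hme hdye lm ldy).eventually_fderiv_mollify lm hdy0
    φ.hasCompactSupport φ.tsupport_subset
  have cd : ∀ n, ContDiff ℝ (⊤ : ℕ∞) (mollify n m) := fun n => contDiff_mollify n lm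
  have lo : ∀ n p, c₀ ≤ mollify n m p := fun n p => le_mollify n lm hm0 p
  have ne : ∀ n p, mollify n m p ≠ 0 := fun n p => (hc₀.trans_le (lo n p)).ne'
  have invb : ∀ n p, |(mollify n m p)⁻¹| ≤ c₀⁻¹ := by
    intro n p
    rw [abs_of_nonneg (inv_nonneg.2 (hc₀.le.trans (lo n p)))]
    exact inv_anti₀ hc₀ (lo n p)
  have tm : ∀ᵐ p ∂(rectMeasure L₁ L₂), Tendsto (fun n => mollify n m p) atTop (𝓝 (lam p)) := by
    filter_upwards [ae_restrict_of_ae (ae_tendsto_mollify lm), hme] with p h1 h2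
    rwa [h2]
  have tx : ∀ᵐ p ∂(rectMeasure L₁ L₂), Tendsto (fun n => mollify n dx p) atTop (𝓝 (lx p)) := by
    filter_upwards [ae_restrict_of_ae (ae_tendsto_mollify ldx), hdxe] with p h1 h2
    rwa [h2]
  have ty : ∀ᵐ p ∂(rectMeasure L₁ L₂), Tendsto (fun n => mollify n dy p) atTop (𝓝 (ly p)) := by
    filter_upwards [ae_restrict_of_ae (ae_tendsto_mollify ldy), hdye] with p h1 h2
    rwa [h2]
  have lpos : ∀ᵐ p ∂(rectMeasure L₁ L₂), lam p ≠ 0 := by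
    filter_upwards [hb] with p hp
    exact (hc₀.trans_le hp.1).ne'
  obtain ⟨Cφ, hCφ⟩ := φ.continuous.bounded_above_of_compact_support φ.hasCompactSupport
  obtain ⟨Cx, hCx⟩ := (continuous_fderiv_test φ (1, 0)).bounded_above_of_compact_support
    (hasCompactSupport_fderiv_test φ (1, 0))
  obtain ⟨Cy, hCy⟩ := (continuous_fderiv_test φ (0, 1)).bounded_above_of_compact_support
    (hasCompactSupport_fderiv_test φ (0, 1))
  simp only [Real.norm_eq_abs] at hCφ hCx hCy
  have pφ : 0 ≤ Cφ := (abs_nonneg _).trans (hCφ 0)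
  have px : 0 ≤ Cx := (abs_nonneg _).trans (hCx 0)
  have py : 0 ≤ Cy := (abs_nonneg _).trans (hCy 0)
  have pMx : 0 ≤ Mx := (abs_nonneg _).trans (hdxb 0)
  have pMy : 0 ≤ My := (abs_nonneg _).trans (hdyb 0)
  have bx : ∀ n p, |mollify n dx p| ≤ Mx := fun n p => abs_le.2
    ⟨le_mollify n ldx (fun t => (abs_le.1 (hdxb t)).1) p,
      mollify_le n ldx (fun t => (abs_le.1 (hdxb t)).2) p⟩
  have bY : ∀ n p, |mollify n dy p| ≤ My := fun n p => abs_le.2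
    ⟨le_mollify n ldy (fun t => (abs_le.1 (hdyb t)).1) p,
      mollify_le n ldy (fun t => (abs_le.1 (hdyb t)).2) p⟩
  have blam : ∀ᵐ p ∂(rectMeasure L₁ L₂), |lam p| ≤ c₁ := by
    filter_upwards [hb] with p hp
    rw [abs_of_nonneg (hc₀.le.trans hp.1)]
    exact hp.2
  have blx : ∀ᵐ p ∂(rectMeasure L₁ L₂), |lx p| ≤ Mx := by
    filter_upwards [hdxe] with p hp
    rw [hp]
    exact hdxb p
  -- near the support of `φ`, the derivatives of `λ_n` are the mollified weak derivatives of `λ`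
  let A : ℕ → ℝ × ℝ → ℝ := fun n p => φ p * (mollify n m p)⁻¹
  let B : ℕ → ℝ × ℝ → ℝ := fun n p =>
    lam p * (fderiv ℝ φ p (1, 0) * (mollify n m p)⁻¹ -
      φ p * (mollify n dx p * ((mollify n m p)⁻¹ * (mollify n m p)⁻¹))) +
    lx p * (φ p * (mollify n m p)⁻¹) +
    (fderiv ℝ φ p (0, 1) * (mollify n m p)⁻¹ -
      φ p * (mollify n dy p * ((mollify n m p)⁻¹ * (mollify n m p)⁻¹)))
  have eqn : ∀ᶠ n in atTop, ∫ p in openRect L₁ L₂, g p * A n p =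
      -∫ p in openRect L₁ L₂, θ p * B n p := by
    filter_upwards [wx, wy] with n hx hy
    have := heq (φ.div (cd n) (ne n))
    simp only [TestFunction.div_apply, TestFunction.fderiv_div_apply] at this
    refine this.trans ?_
    congr 1
    refine integral_congr_ae (Eventually.of_forall fun p => ?_)
    -- The derivatives of `λ_n` are identified only on the support of `φ`; elsewhere they are
    -- multiplied by `φ = 0`.
    by_cases hp : p ∈ tsupport φ
    · simp only [B]
      rw [hx p hp, hy p hp]
    · simp [B, image_eq_zero_of_notMem_tsupport hp]
  have cm : ∀ n, Continuous fun p => (mollify n m p)⁻¹ := fun n =>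
    (cd n).continuous.inv₀ (ne n)
  have cdx : ∀ n, Continuous (mollify n dx) := fun n => (contDiff_mollify n ldx).continuous
  have cdy : ∀ n, Continuous (mollify n dy) := fun n => (contDiff_mollify n ldy).continuous
  have limA : Tendsto (fun n => ∫ p in openRect L₁ L₂, g p * A n p) atTop
      (𝓝 (∫ p in openRect L₁ L₂, g p * (φ p * (lam p)⁻¹))) := by
    refine tendsto_integral_mul_of_bounded (C := Cφ * c₀⁻¹) hg
      (fun n => (φ.continuous.mul (cm n)).aestronglyMeasurable)
      (Eventually.of_forall fun n => Eventually.of_forall fun p => ?_) ?_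
    · rw [abs_mul]
      gcongr
      exacts [hCφ p, invb n p]
    · filter_upwards [tm, lpos] with p h1 h2
      exact (h1.inv₀ h2).const_mul _
  have limB : Tendsto (fun n => ∫ p in openRect L₁ L₂, θ p * B n p) atTop
      (𝓝 (∫ p in openRect L₁ L₂, θ p *
      (fderiv ℝ φ p (1, 0) + fderiv ℝ φ p (0, 1) * (lam p)⁻¹ -
        φ p * (ly p * ((lam p)⁻¹ * (lam p)⁻¹))))) := by
    refine tendsto_integral_mul_of_bounded (C := c₁ * (Cx * c₀⁻¹ + Cφ * (Mx * (c₀⁻¹ * c₀⁻¹))) +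
      Mx * (Cφ * c₀⁻¹) + (Cy * c₀⁻¹ + Cφ * (My * (c₀⁻¹ * c₀⁻¹)))) hθ (fun n => ?_)
      (Eventually.of_forall fun n => ?_) ?_
    · have m1 : AEStronglyMeasurable (fun p => fderiv ℝ φ p (1, 0) * (mollify n m p)⁻¹ -
          φ p * (mollify n dx p * ((mollify n m p)⁻¹ * (mollify n m p)⁻¹)))
          (rectMeasure L₁ L₂) :=
        (((continuous_fderiv_test φ (1, 0)).mul (cm n)).sub
          (φ.continuous.mul ((cdx n).mul ((cm n).mul (cm n))))).aestronglyMeasurable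
      have m2 : AEStronglyMeasurable (fun p => fderiv ℝ φ p (0, 1) * (mollify n m p)⁻¹ -
          φ p * (mollify n dy p * ((mollify n m p)⁻¹ * (mollify n m p)⁻¹)))
          (rectMeasure L₁ L₂) :=
        (((continuous_fderiv_test φ (0, 1)).mul (cm n)).sub
          (φ.continuous.mul ((cdy n).mul ((cm n).mul (cm n))))).aestronglyMeasurable
      exact ((hae.mul m1).add (hlx.1.mul
        (φ.continuous.mul (cm n)).aestronglyMeasurable)).add m2
    · filter_upwards [blam, blx] with p h1 h2
      have i := invb n p
      have hφp := hCφ p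
      have hxp := hCx p
      have hyp := hCy p
      have hbx := bx n p
      have hby := bY n p
      simp only [B]
      refine (abs_add_le _ _).trans (add_le_add ((abs_add_le _ _).trans (add_le_add ?_ ?_)) ?_)
      · rw [abs_mul]
        refine mul_le_mul h1 ((abs_sub _ _).trans ?_) (abs_nonneg _) hc₁.le
        simp only [abs_mul]
        gcongr
      · simp only [abs_mul]
        gcongr
      · refine (abs_sub _ _).trans ?_
        simp only [abs_mul]
        gcongr
    · filter_upwards [tm, tx, ty, lpos] with p h1 h2 h3 h4
      have hi := h1.inv₀ h4
      have := ((((hi.const_mul (fderiv ℝ φ p (1, 0))).sub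
        ((h2.mul (hi.mul hi)).const_mul (φ p))).const_mul (lam p)).add
        ((hi.const_mul (φ p)).const_mul (lx p))).add ((hi.const_mul (fderiv ℝ φ p (0, 1))).sub
        ((h3.mul (hi.mul hi)).const_mul (φ p)))
      -- In the limit the two terms in `λ_x` cancel: `-λ φ λ_x/λ² + λ_x φ/λ = 0`.
      convert this using 2
      field_simp
      ring
  exact tendsto_nhds_unique limA (limB.neg.congr' (eqn.mono fun n hn => hn.symm))

/-! ### Uniqueness of traces and the case of continuous functions -/

theorem IsRepresentedBy.congr {L : ℝ} {F : HMinusOne L} {f g : ℝ → ℝ} (h : IsRepresentedBy F f)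
    (e : f =ᵐ[intervalMeasure L] g) : IsRepresentedBy F g := by
  refine ⟨(memLp_congr_ae e).1 h.1, fun u => (h.2 u).trans (integral_congr_ae ?_)⟩
  filter_upwards [e] with x hx
  rw [hx]

theorem IsRepresentedBy.eq {L : ℝ} {F G : HMinusOne L} {f : ℝ → ℝ} (hF : IsRepresentedBy F f)
    (hG : IsRepresentedBy G f) : F = G :=
  ContinuousLinearMap.ext fun u => (hF.2 u).trans (hG.2 u).symm

theorem restrict_Icc_eq_intervalMeasure (l : ℝ) :
    (volume : Measure ℝ).restrict (Icc 0 l) = intervalMeasure l :=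
  (Measure.restrict_congr_set Ioo_ae_eq_Icc).symm

/-- Two families continuous on `[0, l]` that represent the same slices for a.e. time agree a.e.,
hence everywhere on `[0, l]`, endpoints included. -/
theorem isTraceAt_iff {l L : ℝ} (hl : 0 < l) {s : ℝ → ℝ → ℝ} {S : ℝ → HMinusOne L}
    (hS : Continuous S) (hs : ∀ᵐ t ∂(intervalMeasure l), IsRepresentedBy (S t) (s t))
    {a : ℝ} (ha : a ∈ Icc 0 l) (F : HMinusOne L) : IsTraceAt l s a F ↔ F = S a := by
  constructor
  · rintro ⟨S', hS', hs', rfl⟩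
    have e : S' =ᵐ[volume.restrict (Icc 0 l)] S := by
      rw [restrict_Icc_eq_intervalMeasure]
      filter_upwards [hs, hs'] with t h1 h2
      exact h2.eq h1
    exact Measure.eqOn_Icc_of_ae_eq volume hl.ne e hS' hS.continuousOn ha
  · rintro rfl
    exact ⟨S, hS.continuousOn, hs, rfl⟩

/-- For fixed `u`, both `t ↦ S(t)u` and `t ↦ ∫ f(t,x) u(x) dx` are continuous on `[0, l]`, the
latter by dominated convergence. They agree a.e., hence at `a`. -/
theorem isRepresentedBy_of_continuousOn {l L : ℝ} (hl : 0 < l) {s : ℝ → ℝ → ℝ}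
    {S : ℝ → HMinusOne L} (hS : Continuous S)
    (hs : ∀ᵐ t ∂(intervalMeasure l), IsRepresentedBy (S t) (s t)) {f : ℝ → ℝ → ℝ}
    (hf : ContinuousOn (fun p : ℝ × ℝ => f p.1 p.2) (Icc 0 l ×ˢ Icc 0 L))
    (hsf : ∀ᵐ t ∂(intervalMeasure l), s t =ᵐ[intervalMeasure L] f t) {a : ℝ}
    (ha : a ∈ Icc 0 l) : IsRepresentedBy (S a) (f a) := by
  obtain ⟨C, hC⟩ := (isCompact_Icc.prod isCompact_Icc).exists_bound_of_continuousOn hf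
  have hI : ∀ᵐ x ∂(intervalMeasure L), x ∈ Icc 0 L := by
    filter_upwards [ae_restrict_mem (openInterval L).isOpen.measurableSet] with x hx
    exact Ioo_subset_Icc_self hx
  have hfm : ∀ t ∈ Icc 0 l, MemLp (f t) 2 (intervalMeasure L) := by
    intro t ht
    refine MemLp.of_bound ?_ C ?_
    · have : ContinuousOn (f t) (Icc 0 L) :=
        hf.comp (f := fun x => (t, x)) (by fun_prop) fun x hx => ⟨ht, hx⟩
      exact (this.mono Ioo_subset_Icc_self).aestronglyMeasurable isOpen_Ioo.measurableSet
    · filter_upwards [hI] with x hx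
      exact hC (t, x) ⟨ht, hx⟩
  refine ⟨hfm a ha, fun u => ?_⟩
  have cont : ContinuousOn (fun t => ∫ x, f t x * u.1.fst x ∂(intervalMeasure L)) (Icc 0 l) := by
    refine continuousOn_of_dominated (bound := fun x => C * |u.1.fst x|)
      (fun t ht => (hfm t ht).1.mul (Lp.memLp _).1) (fun t ht => ?_) ?_ ?_
    · filter_upwards [hI] with x hx
      rw [norm_mul]
      exact mul_le_mul_of_nonneg_right (hC (t, x) ⟨ht, hx⟩) (norm_nonneg _)
    · exact (((Lp.memLp u.1.fst).integrable (by norm_num)).abs).const_mul C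
    · filter_upwards [hI] with x hx
      exact (hf.comp (f := fun t => (t, x)) (by fun_prop) fun t ht => ⟨ht, hx⟩).mul
        continuousOn_const
  have e : (fun t => S t u) =ᵐ[volume.restrict (Icc 0 l)]
      fun t => ∫ x, f t x * u.1.fst x ∂(intervalMeasure L) := by
    rw [restrict_Icc_eq_intervalMeasure]
    filter_upwards [hs, hsf] with t h1 h2
    exact (h1.congr h2).2 u
  exact Measure.eqOn_Icc_of_ae_eq volume hl.ne e
    (hS.clm_apply continuous_const).continuousOn cont ha

/-! ### The two evolution equations for an element of the graph space -/

/-- Multiplication by a bounded function on `L²`. -/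
def mulLp {α : Type*} [MeasurableSpace α] {μ : Measure α} {f : α → ℝ} (hf : MemLp f ∞ μ) :
    Lp ℝ 2 μ →L[ℝ] Lp ℝ 2 μ :=
  (ContinuousLinearMap.mul ℝ ℝ).holderL μ ∞ 2 2 hf.toLp

theorem coeFn_mulLp {α : Type*} [MeasurableSpace α] {μ : Measure α} {f : α → ℝ}
    (hf : MemLp f ∞ μ) (F : Lp ℝ 2 μ) : mulLp hf F =ᵐ[μ] fun p => f p * F p := by
  filter_upwards [(ContinuousLinearMap.mul ℝ ℝ).coeFn_holder (r := 2) hf.toLp F,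
    hf.coeFn_toLp] with p h1 h2
  rw [mulLp, ContinuousLinearMap.holderL_apply_apply, h1, h2]
  rfl

section Operators

variable {L₁ L₂ : ℝ} {lam : ℝ × ℝ → ℝ} (h : PositiveZeroCondition L₁ L₂ lam)

/-- The inclusion `X₁⁰(Ω) → L²(Ω)`. -/
def X10incl : X10 h →L[ℝ] Lp ℝ 2 (rectMeasure L₁ L₂) :=
  (WithLp.fstL 2 ℝ (Lp ℝ 2 (rectMeasure L₁ L₂)) (Lp ℝ 2 (rectMeasure L₁ L₂))).comp
    (X10 h).subtypeL

/-- The operator `T : X₁⁰(Ω) → L²(Ω)`. -/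
def X10transport : X10 h →L[ℝ] Lp ℝ 2 (rectMeasure L₁ L₂) :=
  (WithLp.sndL 2 ℝ (Lp ℝ 2 (rectMeasure L₁ L₂)) (Lp ℝ 2 (rectMeasure L₁ L₂))).comp
    (X10 h).subtypeL

theorem isTransport_X10 (w : X10 h) : IsTransport L₁ L₂ lam (X10incl h w) (X10transport h w) :=
  w.2

end Operators

theorem PositiveZeroCondition.memLp_top {L₁ L₂ : ℝ} {lam : ℝ × ℝ → ℝ}
    (h : PositiveZeroCondition L₁ L₂ lam) : MemLp lam ∞ (rectMeasure L₁ L₂) := by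
  obtain ⟨c₀, c₁, h0, h1, hb⟩ := h.bounds
  refine memLp_top_of_bound h.aestronglyMeasurable c₁ ?_
  filter_upwards [hb] with p hp
  rw [Real.norm_eq_abs, abs_of_nonneg (h0.le.trans hp.1)]
  exact hp.2

theorem PositiveZeroCondition.memLp_inv {L₁ L₂ : ℝ} {lam : ℝ × ℝ → ℝ}
    (h : PositiveZeroCondition L₁ L₂ lam) : MemLp (fun p => (lam p)⁻¹) ∞ (rectMeasure L₁ L₂) := by
  obtain ⟨c₀, c₁, h0, h1, hb⟩ := h.bounds
  refine memLp_top_of_bound h.aestronglyMeasurable.aemeasurable.inv.aestronglyMeasurable c₀⁻¹ ?_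
  filter_upwards [hb] with p hp
  rw [Real.norm_eq_abs, abs_of_nonneg (inv_nonneg.2 (h0.le.trans hp.1))]
  exact inv_anti₀ h0 hp.1

/-- The product `p ↦ f p.1 * g p.2` of test functions as a test function on the rectangle. -/
def tensorTest {L₁ L₂ : ℝ} (f : 𝓓(openInterval L₁, ℝ)) (g : 𝓓(openInterval L₂, ℝ)) :
    𝓓(openRect L₁ L₂, ℝ) where
  toFun p := f p.1 * g p.2
  contDiff' := (f.contDiff.comp contDiff_fst).mul (g.contDiff.comp contDiff_snd)
  hasCompactSupport' := HasCompactSupport.of_support_subset_isCompact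
    (f.hasCompactSupport.prod g.hasCompactSupport) fun p hp =>
      ⟨subset_tsupport _ (left_ne_zero_of_mul hp), subset_tsupport _ (right_ne_zero_of_mul hp)⟩
  tsupport_subset' := by
    refine (closure_minimal (t := tsupport f ×ˢ tsupport g) (fun p hp =>
      ⟨subset_tsupport _ (left_ne_zero_of_mul hp), subset_tsupport _ (right_ne_zero_of_mul hp)⟩)
      ((isClosed_tsupport _).prod (isClosed_tsupport _))).trans fun p hp => ?_
    exact ⟨f.tsupport_subset hp.1, g.tsupport_subset hp.2⟩

theorem fderiv_tensorTest {L₁ L₂ : ℝ} (f : 𝓓(openInterval L₁, ℝ)) (g : 𝓓(openInterval L₂, ℝ))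
    (p v : ℝ × ℝ) : fderiv ℝ (tensorTest f g) p v =
      deriv f p.1 * v.1 * g p.2 + f p.1 * (deriv g p.2 * v.2) := by
  have h1 : HasFDerivAt (fun q : ℝ × ℝ => f q.1) _ p :=
    (((f.contDiff.differentiable (by simp)) p.1).hasDerivAt.hasFDerivAt).comp p hasFDerivAt_fst
  have h2 : HasFDerivAt (fun q : ℝ × ℝ => g q.2) _ p :=
    (((g.contDiff.differentiable (by simp)) p.2).hasDerivAt.hasFDerivAt).comp p hasFDerivAt_snd
  have h3 : HasFDerivAt (tensorTest f g) _ p := h1.mul h2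
  rw [h3.fderiv]
  simp
  ring

/-- Treating the identity as a coordinate change, alongside the swap, lets one construction serve
both pairs of sides. -/
theorem measurePreserving_id_cyl (L₁ L₂ : ℝ) :
    MeasurePreserving id (cylMeasure L₁ L₂) (rectMeasure L₁ L₂) := by
  rw [rectMeasure_eq_prod]
  exact MeasurePreserving.id _

theorem measurePreserving_swap_cyl (L₁ L₂ : ℝ) :
    MeasurePreserving Prod.swap (cylMeasure L₂ L₁) (rectMeasure L₁ L₂) := by
  rw [rectMeasure_eq_prod]
  exact Measure.measurePreserving_swap

/-- Composition with a measure preserving map, as an operator on `L²`. -/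
def pullLp {α β : Type*} [MeasurableSpace α] [MeasurableSpace β] {μ : Measure α} {ν : Measure β}
    {e : α → β} (he : MeasurePreserving e μ ν) : Lp ℝ 2 ν →L[ℝ] Lp ℝ 2 μ :=
  (Lp.compMeasurePreservingₗᵢ ℝ e he).toContinuousLinearMap

theorem coeFn_pullLp {α β : Type*} [MeasurableSpace α] [MeasurableSpace β] {μ : Measure α}
    {ν : Measure β} {e : α → β} (he : MeasurePreserving e μ ν) (F : Lp ℝ 2 ν) :
    pullLp he F =ᵐ[μ] F ∘ e :=
  Lp.coeFn_compMeasurePreserving F he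

/-- A weak formulation on the rectangle, in coordinates `e`, gives an evolution equation. -/
theorem isWeakEvolution_pullLp {l L : ℝ} {ν : Measure (ℝ × ℝ)} {e : ℝ × ℝ → ℝ × ℝ}
    (he : MeasurePreserving e (cylMeasure l L) ν) (hemb : MeasurableEmbedding e)
    (hinv : e ∘ e = id) {θ a b : Lp ℝ 2 ν}
    (H : ∀ (η : 𝓓(openInterval l, ℝ)) (u : 𝓓(openInterval L, ℝ)),
      ∫ p, θ p * (deriv η (e p).1 * u (e p).2) ∂ν =
        -∫ p, (a p * (η (e p).1 * u (e p).2) + b p * (η (e p).1 * deriv u (e p).2)) ∂ν) :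
    IsWeakEvolution l L (pullLp he θ) (pullLp he a) (pullLp he b) := by
  intro η u
  have := H η u
  have ee : ∀ p, e (e p) = p := congrFun hinv
  rw [← he.integral_comp hemb, ← he.integral_comp hemb] at this
  simp only [ee] at this
  refine Eq.trans (integral_congr_ae ?_) (this.trans (congrArg Neg.neg (integral_congr_ae ?_)))
  · filter_upwards [coeFn_pullLp he θ] with p h1
    rw [h1]; rfl
  · filter_upwards [coeFn_pullLp he a, coeFn_pullLp he b] with p h1 h2
    rw [h1, h2]; rfl

theorem integral_add_sub {α : Type*} [MeasurableSpace α] {μ : Measure α} {f g k : α → ℝ}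
    (hf : Integrable f μ) (hg : Integrable g μ) (hk : Integrable k μ) :
    ∫ x, (f x + (g x - k x)) ∂μ = ∫ x, f x ∂μ + (∫ x, g x ∂μ - ∫ x, k x ∂μ) := by
  rw [← integral_sub hg hk]
  exact integral_add hf (hg.sub hk)

/-- `∂ₓ θ = (Tθ / λ - (λ_y / λ²) θ) - ∂_y (θ / λ)`. -/
theorem isWeakEvolution_x {L₁ L₂ : ℝ} {lam ly : ℝ × ℝ → ℝ} (h : PositiveZeroCondition L₁ L₂ lam)
    (hly : MemLp ly ∞ (rectMeasure L₁ L₂))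
    (hwy : IsWeakPartial (openRect L₁ L₂) (0, 1) lam ly)
    (hm : MemLp (fun p => ly p * ((lam p)⁻¹ * (lam p)⁻¹)) ∞ (rectMeasure L₁ L₂)) (w : X10 h) :
    IsWeakEvolution L₁ L₂ (pullLp (measurePreserving_id_cyl L₁ L₂) (X10incl h w))
      (pullLp (measurePreserving_id_cyl L₁ L₂)
        (mulLp h.memLp_inv (X10transport h w) - mulLp hm (X10incl h w)))
      (pullLp (measurePreserving_id_cyl L₁ L₂) (mulLp h.memLp_inv (X10incl h w))) := by
  refine isWeakEvolution_pullLp (measurePreserving_id_cyl L₁ L₂) MeasurableEmbedding.id rfl fun η u => ?_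
  simp only [id]
  set φ := tensorTest η u
  have main := h.integral_div hly hwy ((Lp.memLp (X10incl h w)).integrable (by norm_num))
    ((Lp.memLp (X10transport h w)).integrable (by norm_num)) (isTransport_X10 h w) φ
  have mφ : MemLp φ 2 (rectMeasure L₁ L₂) := memLp_two_test φ.continuous φ.hasCompactSupport
  have mx := memLp_two_test (L₁ := L₁) (L₂ := L₂) (continuous_fderiv_test φ (1, 0))
    (hasCompactSupport_fderiv_test φ (1, 0))
  have my := memLp_two_test (L₁ := L₁) (L₂ := L₂) (continuous_fderiv_test φ (0, 1))
    (hasCompactSupport_fderiv_test φ (0, 1))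
  have ex : ∀ p, fderiv ℝ φ p (1, 0) = deriv η p.1 * u p.2 := fun p => by
    rw [fderiv_tensorTest]; simp
  have ey : ∀ p, fderiv ℝ φ p (0, 1) = η p.1 * deriv u p.2 := fun p => by
    rw [fderiv_tensorTest]; simp
  simp only [← ex, ← ey]
  change ∫ p, X10incl h w p * _ ∂(rectMeasure L₁ L₂) =
    -∫ p, (_ * φ p + _) ∂(rectMeasure L₁ L₂)
  -- The term `θ φ_x` is added and subtracted: the first summand and the bracket cancel in the
  -- integral by `main`, leaving `∫ θ φ_x`.
  have ae : ∀ᵐ p ∂(rectMeasure L₁ L₂),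
      (mulLp h.memLp_inv (X10transport h w) - mulLp hm (X10incl h w) :
        Lp ℝ 2 (rectMeasure L₁ L₂)) p * φ p +
      mulLp h.memLp_inv (X10incl h w) p * fderiv ℝ φ p (0, 1) =
      X10transport h w p * (φ p * (lam p)⁻¹) +
      (X10incl h w p * (fderiv ℝ φ p (1, 0) + fderiv ℝ φ p (0, 1) * (lam p)⁻¹ -
        φ p * (ly p * ((lam p)⁻¹ * (lam p)⁻¹))) - X10incl h w p * fderiv ℝ φ p (1, 0)) := by
    filter_upwards [Lp.coeFn_sub (mulLp h.memLp_inv (X10transport h w)) (mulLp hm (X10incl h w)),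
      coeFn_mulLp h.memLp_inv (X10transport h w), coeFn_mulLp hm (X10incl h w),
      coeFn_mulLp h.memLp_inv (X10incl h w)] with p h1 h2 h3 h4
    rw [h1, Pi.sub_apply, h2, h3, h4]
    ring
  have i1 : Integrable (fun p => X10transport h w p * (φ p * (lam p)⁻¹)) (rectMeasure L₁ L₂) :=
    (Lp.memLp (X10transport h w)).integrable_mul (h.memLp_inv.mul' (r := 2) mφ)
  have i2 : Integrable (fun p => X10incl h w p * fderiv ℝ φ p (1, 0)) (rectMeasure L₁ L₂) :=
    (Lp.memLp (X10incl h w)).integrable_mul mx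
  have i3 : Integrable (fun p => X10incl h w p * (fderiv ℝ φ p (1, 0) +
      fderiv ℝ φ p (0, 1) * (lam p)⁻¹ - φ p * (ly p * ((lam p)⁻¹ * (lam p)⁻¹))))
      (rectMeasure L₁ L₂) :=
    (Lp.memLp (X10incl h w)).integrable_mul
      ((mx.add (h.memLp_inv.mul' (r := 2) my)).sub (hm.mul' (r := 2) mφ))
  rw [integral_congr_ae ae, integral_add_sub i1 i3 i2, main]
  ring

/-- `∂_y θ = (Tθ + λₓ θ) - ∂ₓ (λ θ)`. -/
theorem isWeakEvolution_y {L₁ L₂ : ℝ} {lam lx : ℝ × ℝ → ℝ} (h : PositiveZeroCondition L₁ L₂ lam)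
    (hlx : MemLp lx ∞ (rectMeasure L₁ L₂))
    (hwx : IsWeakPartial (openRect L₁ L₂) (1, 0) lam lx) (w : X10 h) :
    IsWeakEvolution L₂ L₁ (pullLp (measurePreserving_swap_cyl L₁ L₂) (X10incl h w))
      (pullLp (measurePreserving_swap_cyl L₁ L₂)
        (X10transport h w + mulLp hlx (X10incl h w)))
      (pullLp (measurePreserving_swap_cyl L₁ L₂) (mulLp h.memLp_top (X10incl h w))) := by
  refine isWeakEvolution_pullLp (measurePreserving_swap_cyl L₁ L₂)
    MeasurableEquiv.prodComm.measurableEmbedding (by ext p <;> rfl)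
    fun η u => ?_
  simp only [Prod.fst_swap, Prod.snd_swap]
  set φ := tensorTest u η
  -- The transport equation carries its own weak derivative `lx'`, which equals `lx` a.e. by
  -- uniqueness. No division by `λ` occurs in this direction, so smooth test functions suffice.
  obtain ⟨lx', hwx', hT⟩ := isTransport_X10 h w
  have main := hT φ
  have mφ : MemLp φ 2 (rectMeasure L₁ L₂) := memLp_two_test φ.continuous φ.hasCompactSupport
  have my := memLp_two_test (L₁ := L₁) (L₂ := L₂) (continuous_fderiv_test φ (0, 1))
    (hasCompactSupport_fderiv_test φ (0, 1))
  have ex : ∀ p, η p.2 * deriv u p.1 = fderiv ℝ φ p (1, 0) := fun p => by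
    rw [fderiv_tensorTest]; simp [mul_comm]
  have ey : ∀ p, deriv η p.2 * u p.1 = fderiv ℝ φ p (0, 1) := fun p => by
    rw [fderiv_tensorTest]; simp [mul_comm]
  have e0 : ∀ p : ℝ × ℝ, η p.2 * u p.1 = φ p := fun p => mul_comm _ _
  simp only [ex, ey, e0]
  have ae : ∀ᵐ p ∂(rectMeasure L₁ L₂),
      (X10transport h w + mulLp hlx (X10incl h w) : Lp ℝ 2 (rectMeasure L₁ L₂)) p * φ p +
      mulLp h.memLp_top (X10incl h w) p * fderiv ℝ φ p (1, 0) =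
      X10transport h w p * φ p +
      (X10incl h w p * (lam p * fderiv ℝ φ p (1, 0) + lx' p * φ p + fderiv ℝ φ p (0, 1)) -
        X10incl h w p * fderiv ℝ φ p (0, 1)) := by
    filter_upwards [Lp.coeFn_add (X10transport h w) (mulLp hlx (X10incl h w)),
      coeFn_mulLp hlx (X10incl h w), coeFn_mulLp h.memLp_top (X10incl h w),
      hwx.ae_eq hwx'] with p h1 h2 h3 h4
    rw [h1, Pi.add_apply, h2, h3, h4]
    ring
  have i1 : Integrable (fun p => X10transport h w p * φ p) (rectMeasure L₁ L₂) :=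
    (Lp.memLp (X10transport h w)).integrable_mul mφ
  have i2 : Integrable (fun p => X10incl h w p * fderiv ℝ φ p (0, 1)) (rectMeasure L₁ L₂) :=
    (Lp.memLp (X10incl h w)).integrable_mul my
  have i3 : Integrable (fun p => X10incl h w p * (lam p * fderiv ℝ φ p (1, 0) + lx' p * φ p +
      fderiv ℝ φ p (0, 1))) (rectMeasure L₁ L₂) :=
    (Lp.memLp (X10incl h w)).integrable_mul (h.memLp_adjoint hwx' φ)
  rw [integral_congr_ae ae, integral_add_sub i1 i3 i2, main]
  ring

/-! ### Assembling the four traces -/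

/-- A family of trace operators represented by `θ` in the coordinates `e`. -/
theorem exists_traceFamily {l L : ℝ} (hl : 0 < l) {X : Type*} [NormedAddCommGroup X]
    [NormedSpace ℝ X] {ν : Measure (ℝ × ℝ)} {e : ℝ × ℝ → ℝ × ℝ}
    (he : MeasurePreserving e (cylMeasure l L) ν) (θ a b : X →L[ℝ] Lp ℝ 2 ν)
    (H : ∀ w, IsWeakEvolution l L (pullLp he (θ w)) (pullLp he (a w)) (pullLp he (b w))) :
    ∃ S : ℝ → X →L[ℝ] HMinusOne L, ∀ w, (Continuous fun t => S t w) ∧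
      ∀ᵐ t ∂(intervalMeasure l), IsRepresentedBy (S t w) (fun x => θ w (e (t, x))) := by
  obtain ⟨ρ, hρ⟩ := exists_test_integral_eq_one hl
  refine ⟨traceOp ρ ((pullLp he).comp θ) ((pullLp he).comp a) ((pullLp he).comp b), fun w =>
    ⟨continuous_traceOp _ _ _ _ w, ?_⟩⟩
  filter_upwards [ae_isRepresentedBy_traceOp hl ρ hρ ((pullLp he).comp θ) ((pullLp he).comp a)
    ((pullLp he).comp b) w (H w), Measure.ae_ae_of_ae_prod (coeFn_pullLp he (θ w))] with t h1 h2
  exact h1.congr h2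

theorem mainTheorem7 (L₁ L₂ : ℝ) (hL₁ : 0 < L₁) (hL₂ : 0 < L₂) (lam : ℝ × ℝ → ℝ)
    (h : PositiveZeroCondition L₁ L₂ lam) :
    ∃ (γx₀ γx₁ : X10 h →L[ℝ] HMinusOne L₂) (γy₀ γy₁ : X10 h →L[ℝ] HMinusOne L₁),
      -- the trace of each `θ` on each side exists, is unique, and is given by these operators
      (∀ θ : X10 h,
        (∀ F, IsTraceAt L₁ (fun x y => X10fun θ (x, y)) 0 F ↔ F = γx₀ θ) ∧
        (∀ F, IsTraceAt L₁ (fun x y => X10fun θ (x, y)) L₁ F ↔ F = γx₁ θ) ∧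
        (∀ F, IsTraceAt L₂ (fun y x => X10fun θ (x, y)) 0 F ↔ F = γy₀ θ) ∧
        (∀ F, IsTraceAt L₂ (fun y x => X10fun θ (x, y)) L₂ F ↔ F = γy₁ θ)) ∧
      -- for `θ` continuous up to the boundary, the traces are the restrictions to the sides
      (∀ (θ : X10 h) (f : ℝ × ℝ → ℝ), ContinuousOn f (Icc 0 L₁ ×ˢ Icc 0 L₂) →
        X10fun θ =ᵐ[rectMeasure L₁ L₂] f →
          IsRepresentedBy (γx₀ θ) (fun y => f (0, y)) ∧
          IsRepresentedBy (γx₁ θ) (fun y => f (L₁, y)) ∧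
          IsRepresentedBy (γy₀ θ) (fun x => f (x, 0)) ∧
          IsRepresentedBy (γy₁ θ) (fun x => f (x, L₂))) := by
  obtain ⟨lx, hlx, hwx⟩ := h.grad_x
  obtain ⟨ly, hly, hwy⟩ := h.grad_y
  have hm : MemLp (fun p => ly p * ((lam p)⁻¹ * (lam p)⁻¹)) ∞ (rectMeasure L₁ L₂) :=
    (h.memLp_inv.mul' (r := ∞) h.memLp_inv).mul' (r := ∞) hly
  -- The data `a`, `b` are given as bounded operators of `θ`, so each `S t` and `R t` is
  -- automatically a continuous linear trace operator.
  obtain ⟨S, hS⟩ := exists_traceFamily hL₁ (measurePreserving_id_cyl L₁ L₂) (X10incl h)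
    ((mulLp h.memLp_inv).comp (X10transport h) - (mulLp hm).comp (X10incl h))
    ((mulLp h.memLp_inv).comp (X10incl h)) fun w => isWeakEvolution_x h hly hwy hm w
  obtain ⟨R, hR⟩ := exists_traceFamily hL₂ (measurePreserving_swap_cyl L₁ L₂) (X10incl h)
    (X10transport h + (mulLp hlx).comp (X10incl h))
    ((mulLp h.memLp_top).comp (X10incl h)) fun w => isWeakEvolution_y h hlx hwx w
  have l₁ := left_mem_Icc.2 hL₁.le
  have r₁ := right_mem_Icc.2 hL₁.le
  have l₂ := left_mem_Icc.2 hL₂.le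
  have r₂ := right_mem_Icc.2 hL₂.le
  refine ⟨S 0, S L₁, R 0, R L₂, fun θ => ?_, fun θ f hf hθf => ?_⟩
  · exact ⟨isTraceAt_iff hL₁ (hS θ).1 (hS θ).2 l₁, isTraceAt_iff hL₁ (hS θ).1 (hS θ).2 r₁,
      isTraceAt_iff hL₂ (hR θ).1 (hR θ).2 l₂, isTraceAt_iff hL₂ (hR θ).1 (hR θ).2 r₂⟩
  · have hx := Measure.ae_ae_of_ae_prod
      ((measurePreserving_id_cyl L₁ L₂).quasiMeasurePreserving.ae hθf)
    have hy := Measure.ae_ae_of_ae_prod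
      ((measurePreserving_swap_cyl L₁ L₂).quasiMeasurePreserving.ae hθf)
    have X : ∀ a ∈ Icc 0 L₁, IsRepresentedBy (S a θ) (fun y => f (a, y)) := fun a ha =>
      isRepresentedBy_of_continuousOn hL₁ (hS θ).1 (hS θ).2 (f := fun x y => f (x, y)) hf hx ha
    have Y : ∀ a ∈ Icc 0 L₂, IsRepresentedBy (R a θ) (fun x => f (x, a)) := fun a ha =>
      isRepresentedBy_of_continuousOn hL₂ (hR θ).1 (hR θ).2 (f := fun y x => f (x, y))
        (hf.comp continuous_swap.continuousOn fun p hp => ⟨hp.2, hp.1⟩) hy ha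
    exact ⟨X 0 l₁, X L₁ r₁, Y 0 l₂, Y L₂ r₂⟩

end
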